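/- Fix $0<p<1$ and let $G$ be an Erdős–Rényi–Rado random graph with parameter $p$: the vertex set is $\mathbb{N}$, and the indicators of the edges $\{i,j\}$, $i<j$, are i.i.d. Bernoulli($p$) random variables. Let $d_G$ be the intrinsic (shortest-path) metric of $G$, which is almost surely finite. Let $\mu$ be a probability measure on $\mathbb{N}$ with full support, i.e. $\mu(\{n\})>0$ for every $n\in\mathbb{N}$, and let $(\xi_i)_{i\ge 1}$ be i.i.d. random elements of $\mathbb{N}$ with law $\mu$ such that the sequence $(\xi_i)_{i\ge1}$ is independent of $G$. For $m\ge 1$ let $X_m:=(\xi_i)_{i=1}^m$ (repetitions are kept) and $$S(X_m):=\Bigl(-\tfrac12\, d_G(\xi_i,\xi_j)^2\Bigr)_{i,j=1}^m,$$ and let $s_+(S(X_m))$ and $s_-(S(X_m))$ be the numbers of positive and of negative eigenvalues of this real symmetric matrix, counted with multiplicity. Then, almost surely, $$\lim_{m\to\infty}\frac{s_+(S(X_m))}{s_-(S(X_m))}=1 .$$ -/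

import Mathlib

/-- The number `s_+(A)` of positive eigenvalues, counted with multiplicity, of a real symmetric
matrix `A`. -/
noncomputable def numPosEigenvalues {m : ℕ} {A : Matrix (Fin m) (Fin m) ℝ}
    (hA : A.IsHermitian) : ℕ :=
  Nat.card {i : Fin m // 0 < hA.eigenvalues i}

/-- The number `s_-(A)` of negative eigenvalues, counted with multiplicity, of a real symmetric
matrix `A`. -/
noncomputable def numNegEigenvalues {m : ℕ} {A : Matrix (Fin m) (Fin m) ℝ}
    (hA : A.IsHermitian) : ℕ :=
  Nat.card {i : Fin m // hA.eigenvalues i < 0}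

/-- The matrix `S(x) = (-d_G(x_i, x_j)² / 2)` of a finite sequence `x` of vertices, possibly with
repetitions, of a graph `G` with its intrinsic (shortest-path) metric `d_G`. -/
noncomputable def distSqMatrix {V : Type*} (G : SimpleGraph V) {m : ℕ} (x : Fin m → V) :
    Matrix (Fin m) (Fin m) ℝ :=
  Matrix.of fun i j => -(1 / 2) * (G.dist (x i) (x j) : ℝ) ^ 2

theorem distSqMatrix_isHermitian {V : Type*} (G : SimpleGraph V) {m : ℕ} (x : Fin m → V) :
    (distSqMatrix G x).IsHermitian := by
  ext i j
  simp [distSqMatrix, SimpleGraph.dist_comm]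

/-- The ratio `Δ(x) = s_+(S(x)) / s_-(S(x))`. -/
noncomputable def signatureRatio {V : Type*} (G : SimpleGraph V) {m : ℕ} (x : Fin m → V) : ℝ :=
  (numPosEigenvalues (distSqMatrix_isHermitian G x) : ℝ) /
    (numNegEigenvalues (distSqMatrix_isHermitian G x) : ℝ)

/-! Almost surely any two vertices of the graph have a common neighbour, so off the diagonal the
squared distance is 4 minus 3 times the edge indicator (`ae_dist_eq`). Repetitions in the sample do
not affect inertia (`sig_kernelMatrix_eq`). On k distinct vertices the matrix is, up to a positive
factor and the addition of a constant matrix, a Wigner matrix: the centered adjacency matrix over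
√k, plus a scalar matrix of order 1/√k (`kernelMatrix_eq_mul_shiftedMatrix_add`). A constant matrix
has rank at most one and moves each index of inertia by at most one. The semicircle law is symmetric
and has no atom at zero, so about k/2 eigenvalues lie on each side of zero.

Only a weak form of the semicircle law is needed: the normalized trace t of the resolvent at z = iη
tends to i·y(η) with y bounded. The Schur complement formula expresses the diagonal resolvent entry
at i through a quadratic form in the edges at i, whose coefficients are independent of these edges.
A second moment estimate replaces this form by its mean, and averaging over i gives s t² + z t + 1 ≈
0 with s = p(1 - p) (`norm_selfConsistent_le`), hence an L¹ error of order k^(-1/2)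
(`integral_norm_trace_sub_semicircleRoot_le`). The real part of t, integrated over η, recovers the
mean sign of the eigenvalues, and the bound on y excludes mass at zero (`tendsto_card_pos_and_neg`).

Along k = (n + 1)⁴ the errors are summable, which gives almost sure convergence; both indices are
monotone in the sample size, so the limit extends to all m (`tendsto_ratio_of_monotone`). All this
concerns a fixed sequence of vertices with infinite range. Full support makes the sample such a
sequence, and independence with Fubini finishes the proof. -/

/-! ### Inertia as the signature of a quadratic form -/

open Matrix in
theorem Matrix.toQuadraticForm'_apply_dotProduct {n : Type*} [Fintype n] [DecidableEq n]
    (A : Matrix n n ℝ) (x : n → ℝ) : A.toQuadraticForm' x = x ⬝ᵥ A *ᵥ x := by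
  simp [Matrix.toQuadraticForm', Matrix.toLinearMap₂'_apply', LinearMap.BilinMap.toQuadraticMap_apply]

open Matrix in
-- The orthogonal change of coordinates `Uᵀ` of the spectral theorem diagonalizes the form. By
-- Sylvester's law, eigenvalue counts then become maximal dimensions of definite subspaces, which
-- are easy to compare.
theorem Matrix.IsHermitian.equivalent_weightedSumSquares {n : Type*} [Fintype n] [DecidableEq n]
    {A : Matrix n n ℝ} (hA : A.IsHermitian) :
    QuadraticMap.Equivalent A.toQuadraticForm'
      (QuadraticMap.weightedSumSquares ℝ hA.eigenvalues) := by
  set U : Matrix n n ℝ := (hA.eigenvectorUnitary).1 with hU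
  have h1 : Uᵀ * U = 1 := by
    have := Unitary.coe_star_mul_self hA.eigenvectorUnitary
    simpa [Matrix.star_eq_conjTranspose] using this
  have h2 : U * Uᵀ = 1 := by
    have := Unitary.coe_mul_star_self hA.eigenvectorUnitary
    simpa [Matrix.star_eq_conjTranspose] using this
  have h3 : A = U * diagonal hA.eigenvalues * Uᵀ := by
    have := hA.spectral_theorem
    rw [Unitary.conjStarAlgAut_apply] at this
    simpa [Matrix.star_eq_conjTranspose, Function.comp_def] using this
  refine ⟨⟨LinearEquiv.ofLinearMap (toLin' Uᵀ) (toLin' U) ?_ ?_, fun x => ?_⟩⟩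
  · rw [← toLin'_mul, h1, toLin'_one]
  · rw [← toLin'_mul, h2, toLin'_one]
  · rw [Matrix.toQuadraticForm'_apply_dotProduct]
    conv_rhs => rw [h3]
    rw [← Matrix.mulVec_mulVec, ← Matrix.mulVec_mulVec, Matrix.dotProduct_mulVec,
      ← Matrix.mulVec_transpose]
    simp [QuadraticMap.weightedSumSquares_apply, dotProduct, Matrix.mulVec_diagonal]
    refine Finset.sum_congr rfl fun i _ => ?_
    ring

theorem Matrix.IsHermitian.sigPos_toQuadraticForm' {n : Type*} [Fintype n] [DecidableEq n]
    {A : Matrix n n ℝ} (hA : A.IsHermitian) :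
    sigPos A.toQuadraticForm' = Nat.card {i : n // 0 < hA.eigenvalues i} :=
  QuadraticForm.sigPos_of_equiv_weightedSumSquares hA.equivalent_weightedSumSquares

theorem Matrix.IsHermitian.sigNeg_toQuadraticForm' {n : Type*} [Fintype n] [DecidableEq n]
    {A : Matrix n n ℝ} (hA : A.IsHermitian) :
    sigNeg A.toQuadraticForm' = Nat.card {i : n // hA.eigenvalues i < 0} :=
  QuadraticForm.sigNeg_of_equiv_weightedSumSquares hA.equivalent_weightedSumSquares

/-! ### Comparison of signatures along linear maps -/

section Comparison
variable {M M' : Type*} [AddCommGroup M] [Module ℝ M]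
  [AddCommGroup M'] [Module ℝ M'] [FiniteDimensional ℝ M']
  {Q : QuadraticForm ℝ M} {Q' : QuadraticForm ℝ M'}

/-- Since `Q' 0 = 0`, the hypothesis makes `L` injective on `V`, so the image is a positive definite
subspace of the same dimension. -/
theorem finrank_le_sigPos_of_pos (L : M →ₗ[ℝ] M') (V : Submodule ℝ M)
    (h : ∀ x ∈ V, x ≠ 0 → 0 < Q' (L x)) : Module.finrank ℝ V ≤ sigPos Q' := by
  have hinj : Function.Injective (L.domRestrict V) := by
    rw [← LinearMap.ker_eq_bot, Submodule.eq_bot_iff]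
    intro x hx
    by_contra hne
    have := h x x.2 (by simpa using hne)
    rw [LinearMap.mem_ker, LinearMap.domRestrict_apply] at hx
    simp [hx] at this
  rw [← LinearMap.finrank_range_of_inj hinj]
  apply le_sigPos_of_posDef
  rintro ⟨y, hy⟩ hne
  obtain ⟨x, rfl⟩ := hy
  rw [QuadraticMap.restrict_apply]
  refine h x x.2 ?_
  rintro h0
  apply hne
  simp [h0]

variable [FiniteDimensional ℝ M]

theorem sigPos_le_sigPos_of_linearMap (L : M →ₗ[ℝ] M') (h : ∀ x, 0 < Q x → 0 < Q' (L x)) :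
    sigPos Q ≤ sigPos Q' := by
  obtain ⟨V, hV, hpos⟩ := exists_finrank_eq_sigPos_and_posDef Q
  rw [← hV]
  refine finrank_le_sigPos_of_pos L V fun x hx hne => ?_
  have := hpos ⟨x, hx⟩ (by simpa using hne)
  rw [QuadraticMap.restrict_apply] at this
  exact h x this

/-- Intersecting a maximal positive subspace with the kernel of one functional costs at most one
dimension. This absorbs the rank-one constant matrix. -/
theorem sigPos_le_sigPos_add_one_of_linearMap (L : M →ₗ[ℝ] M') (φ : M →ₗ[ℝ] ℝ)
    (h : ∀ x, φ x = 0 → 0 < Q x → 0 < Q' (L x)) : sigPos Q ≤ sigPos Q' + 1 := by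
  obtain ⟨V, hV, hpos⟩ := exists_finrank_eq_sigPos_and_posDef Q
  have h1 : Module.finrank ℝ (V ⊓ LinearMap.ker φ : Submodule ℝ M) ≤ sigPos Q' := by
    refine finrank_le_sigPos_of_pos L _ fun x hx hne => ?_
    have := hpos ⟨x, hx.1⟩ (by simpa using hne)
    rw [QuadraticMap.restrict_apply] at this
    exact h x hx.2 this
  have h2 := Submodule.finrank_sup_add_finrank_inf_eq V (LinearMap.ker φ)
  have h3 := Submodule.finrank_le (V ⊔ LinearMap.ker φ)
  have h4 := LinearMap.finrank_range_add_finrank_ker φ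
  have h5 := Submodule.finrank_le (LinearMap.range φ)
  rw [Module.finrank_self] at h5
  omega

theorem sigNeg_le_sigNeg_of_linearMap (L : M →ₗ[ℝ] M') (h : ∀ x, Q x < 0 → Q' (L x) < 0) :
    sigNeg Q ≤ sigNeg Q' := by
  rw [← sigPos_neg, ← sigPos_neg]
  exact sigPos_le_sigPos_of_linearMap L fun x => by simpa using h x

theorem sigNeg_le_sigNeg_add_one_of_linearMap (L : M →ₗ[ℝ] M') (φ : M →ₗ[ℝ] ℝ)
    (h : ∀ x, φ x = 0 → Q x < 0 → Q' (L x) < 0) : sigNeg Q ≤ sigNeg Q' + 1 := by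
  rw [← sigPos_neg, ← sigPos_neg]
  exact sigPos_le_sigPos_add_one_of_linearMap L φ fun x hx => by simpa using h x hx

end Comparison

/-- The matrix obtained from `H` by replacing the row and the column of index `i` by zero. -/
def Matrix.isolate {ι : Type*} [DecidableEq ι] (H : Matrix ι ι ℝ) (i : ι) : Matrix ι ι ℝ :=
  Matrix.of fun a b => if a = i ∨ b = i then 0 else H a b

theorem Matrix.IsSymm.isolate {ι : Type*} [DecidableEq ι] {H : Matrix ι ι ℝ} (hH : H.IsSymm)
    (i : ι) : (H.isolate i).IsSymm := by
  ext a b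
  simp [Matrix.isolate, hH.apply a b, or_comm]

/-! ### Resolvent bounds, Schur complement and the self-consistent equation -/

section Resolvent
variable {ι : Type*} [Fintype ι] [DecidableEq ι]

open Matrix

theorem sum_norm_sq_eq_re_star_dotProduct {ι : Type*} [Fintype ι] (u : ι → ℂ) :
    star u ⬝ᵥ u = ((∑ j, ‖u j‖ ^ 2 : ℝ) : ℂ) := by
  simp only [dotProduct, Pi.star_apply, RCLike.star_def]
  push_cast
  exact Finset.sum_congr rfl fun j _ => Complex.conj_mul' _

/-- Cauchy-Schwarz for a product of complex sums. -/
theorem norm_sum_mul_sq_le {ι : Type*} [Fintype ι] (u v : ι → ℂ) :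
    ‖∑ j, u j * v j‖ ^ 2 ≤ (∑ j, ‖u j‖ ^ 2) * ∑ j, ‖v j‖ ^ 2 := by
  calc ‖∑ j, u j * v j‖ ^ 2 ≤ (∑ j, ‖u j‖ * ‖v j‖) ^ 2 := by
        gcongr
        exact (norm_sum_le _ _).trans_eq (by simp)
    _ ≤ _ := Finset.sum_mul_sq_le_sq_mul_sq _ _ _

/-- In the imaginary part of ⟨u, (H - z)u⟩ the Hermitian part drops out, leaving -Im z · ‖u‖²;
Cauchy-Schwarz does the rest. Stated without an inverse, the bound also yields invertibility of H -
z. -/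
theorem im_sq_mul_sum_le_of_mulVec_eq {H : Matrix ι ι ℝ} (hH : H.IsSymm) {z : ℂ}
    {u v : ι → ℂ} (h : (H.map Complex.ofReal - z • (1 : Matrix ι ι ℂ)) *ᵥ u = v) :
    z.im ^ 2 * ∑ j, ‖u j‖ ^ 2 ≤ ∑ j, ‖v j‖ ^ 2 := by
  have hherm : (H.map Complex.ofReal).IsHermitian := by
    ext a b
    simp [hH.apply a b]
  have him : (star u ⬝ᵥ v).im = -(z.im * ∑ j, ‖u j‖ ^ 2) := by
    rw [← h, sub_mulVec, dotProduct_sub, smul_mulVec, one_mulVec, dotProduct_smul,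
      sum_norm_sq_eq_re_star_dotProduct, Complex.sub_im]
    have := hherm.im_star_dotProduct_mulVec_self u
    simp only [RCLike.im_to_complex] at this
    rw [this, smul_eq_mul, Complex.im_mul_ofReal, zero_sub]
  set U := ∑ j, ‖u j‖ ^ 2 with hU
  set V := ∑ j, ‖v j‖ ^ 2
  have hU0 : 0 ≤ U := by positivity
  have hV0 : 0 ≤ V := by positivity
  have hcs : ‖star u ⬝ᵥ v‖ ^ 2 ≤ U * V := by
    have := norm_sum_mul_sq_le (star u) v
    simpa [dotProduct] using this
  have h1 : (z.im * U) ^ 2 ≤ U * V := by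
    refine le_trans ?_ hcs
    rw [← neg_sq, ← him, ← sq_abs]
    gcongr
    exact Complex.abs_im_le_norm _
  rcases hU0.eq_or_lt with h0 | h0
  · rw [← h0]; simpa using hV0
  · have : U * (z.im ^ 2 * U) ≤ U * V := by nlinarith
    exact le_of_mul_le_mul_left this h0

/-- The resolvent `(H - z)⁻¹` of a real matrix at a complex number. -/
noncomputable def greenMatrix (H : Matrix ι ι ℝ) (z : ℂ) : Matrix ι ι ℂ :=
  (H.map Complex.ofReal - z • (1 : Matrix ι ι ℂ))⁻¹

variable {H : Matrix ι ι ℝ} {z : ℂ}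

theorem isUnit_sub_smul_one (hH : H.IsSymm) (hz : 0 < z.im) :
    IsUnit (H.map Complex.ofReal - z • (1 : Matrix ι ι ℂ)) := by
  rw [← Matrix.mulVec_injective_iff_isUnit]
  refine (injective_iff_map_eq_zero
    (Matrix.mulVecLin (H.map Complex.ofReal - z • (1 : Matrix ι ι ℂ)))).2 fun u hu => ?_
  have := im_sq_mul_sum_le_of_mulVec_eq hH (u := u) hu
  simp only [Pi.zero_apply, norm_zero, ne_eq, OfNat.ofNat_ne_zero, not_false_eq_true, zero_pow,
    Finset.sum_const_zero] at this
  have h0 : ∑ j, ‖u j‖ ^ 2 = 0 := by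
    refine le_antisymm ?_ (by positivity)
    by_contra! hpos
    have : 0 < z.im ^ 2 * ∑ j, ‖u j‖ ^ 2 := by positivity
    linarith
  rw [Finset.sum_eq_zero_iff_of_nonneg (fun _ _ => by positivity)] at h0
  ext j
  simpa using h0 j (Finset.mem_univ j)

theorem mul_greenMatrix (hH : H.IsSymm) (hz : 0 < z.im) :
    (H.map Complex.ofReal - z • (1 : Matrix ι ι ℂ)) * greenMatrix H z = 1 :=
  Matrix.mul_nonsing_inv _ ((Matrix.isUnit_iff_isUnit_det _).1 (isUnit_sub_smul_one hH hz))

theorem greenMatrix_mul (hH : H.IsSymm) (hz : 0 < z.im) :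
    greenMatrix H z * (H.map Complex.ofReal - z • (1 : Matrix ι ι ℂ)) = 1 :=
  Matrix.nonsing_inv_mul _ ((Matrix.isUnit_iff_isUnit_det _).1 (isUnit_sub_smul_one hH hz))

theorem greenMatrix_transpose (hH : H.IsSymm) : (greenMatrix H z)ᵀ = greenMatrix H z := by
  rw [greenMatrix, Matrix.transpose_nonsing_inv, Matrix.transpose_sub, Matrix.transpose_smul,
    Matrix.transpose_one, ← Matrix.transpose_map, hH.eq]

theorem greenMatrix_apply_comm (hH : H.IsSymm) (a b : ι) :
    greenMatrix H z a b = greenMatrix H z b a := by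
  conv_lhs => rw [← greenMatrix_transpose hH]
  rfl

theorem im_sq_mul_sum_greenMatrix_mulVec_le (hH : H.IsSymm) (hz : 0 < z.im) (v : ι → ℂ) :
    z.im ^ 2 * ∑ j, ‖(greenMatrix H z *ᵥ v) j‖ ^ 2 ≤ ∑ j, ‖v j‖ ^ 2 := by
  refine im_sq_mul_sum_le_of_mulVec_eq hH ?_
  rw [Matrix.mulVec_mulVec, mul_greenMatrix hH hz, Matrix.one_mulVec]

theorem sum_norm_sq_greenMatrix_col_le (hH : H.IsSymm) (hz : 0 < z.im) (i : ι) :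
    ∑ j, ‖greenMatrix H z j i‖ ^ 2 ≤ 1 / z.im ^ 2 := by
  rw [le_div_iff₀' (by positivity)]
  have := im_sq_mul_sum_greenMatrix_mulVec_le hH hz (Pi.single i 1)
  simpa [Matrix.mulVec_single_one, Pi.single_apply, apply_ite] using this

theorem sum_norm_sq_greenMatrix_row_le (hH : H.IsSymm) (hz : 0 < z.im) (i : ι) :
    ∑ j, ‖greenMatrix H z i j‖ ^ 2 ≤ 1 / z.im ^ 2 := by
  simpa only [greenMatrix_apply_comm hH i] using sum_norm_sq_greenMatrix_col_le hH hz i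

theorem norm_greenMatrix_apply_le (hH : H.IsSymm) (hz : 0 < z.im) (i j : ι) :
    ‖greenMatrix H z i j‖ ≤ 1 / z.im := by
  have h1 := sum_norm_sq_greenMatrix_col_le hH hz j
  have h2 : ‖greenMatrix H z i j‖ ^ 2 ≤ ∑ a, ‖greenMatrix H z a j‖ ^ 2 :=
    Finset.single_le_sum (f := fun a => ‖greenMatrix H z a j‖ ^ 2)
      (fun _ _ => by positivity) (Finset.mem_univ i)
  refine le_of_sq_le_sq (by rw [one_div, inv_pow, ← one_div]; exact h2.trans h1) (by positivity)

/-- Diagonalization links the resolvent to the Stieltjes transform of the eigenvalue distribution.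
-/
theorem trace_greenMatrix (hH : H.IsHermitian) (hz : 0 < z.im) :
    (greenMatrix H z).trace = ∑ a, ((hH.eigenvalues a : ℂ) - z)⁻¹ := by
  set U : Matrix ι ι ℝ := (hH.eigenvectorUnitary).1 with hU
  have h1 : Uᵀ * U = 1 := by
    have := Unitary.coe_star_mul_self hH.eigenvectorUnitary
    simpa [Matrix.star_eq_conjTranspose] using this
  have h2 : U * Uᵀ = 1 := by
    have := Unitary.coe_mul_star_self hH.eigenvectorUnitary
    simpa [Matrix.star_eq_conjTranspose] using this
  have h3 : H = U * diagonal hH.eigenvalues * Uᵀ := by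
    have := hH.spectral_theorem
    rw [Unitary.conjStarAlgAut_apply] at this
    simpa [Matrix.star_eq_conjTranspose, Function.comp_def] using this
  have hmul : ∀ A B : Matrix ι ι ℝ, (A * B).map Complex.ofReal =
      A.map Complex.ofReal * B.map Complex.ofReal :=
    fun A B => Matrix.map_mul (f := Complex.ofRealHom)
  set V : Matrix ι ι ℂ := U.map Complex.ofReal
  have h1' : Vᵀ * V = 1 := by
    have := congrArg (fun A : Matrix ι ι ℝ => A.map Complex.ofReal) h1
    simpa [hmul, Matrix.transpose_map, V] using this
  have h2' : V * Vᵀ = 1 := by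
    have := congrArg (fun A : Matrix ι ι ℝ => A.map Complex.ofReal) h2
    simpa [hmul, Matrix.transpose_map, V] using this
  have h3' : H.map Complex.ofReal = V * diagonal (fun a => (hH.eigenvalues a : ℂ)) * Vᵀ := by
    have := congrArg (fun A : Matrix ι ι ℝ => A.map Complex.ofReal) h3
    simpa [hmul, Matrix.transpose_map, V, Matrix.diagonal_map, Function.comp_def] using this
  have hne : ∀ a, (hH.eigenvalues a : ℂ) - z ≠ 0 := fun a h => by
    have := congrArg Complex.im h
    simp at this
    linarith
  have h4 : H.map Complex.ofReal - z • (1 : Matrix ι ι ℂ) =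
      V * diagonal (fun a => (hH.eigenvalues a : ℂ) - z) * Vᵀ := by
    have : diagonal (fun a => (hH.eigenvalues a : ℂ) - z) =
        diagonal (fun a => (hH.eigenvalues a : ℂ)) - z • (1 : Matrix ι ι ℂ) := by
      rw [Matrix.smul_one_eq_diagonal, Matrix.diagonal_sub]
    rw [this, Matrix.mul_sub, Matrix.sub_mul, ← h3', Matrix.mul_smul, Matrix.smul_mul,
      Matrix.mul_one, h2']
  have h5 : greenMatrix H z = V * diagonal (fun a => ((hH.eigenvalues a : ℂ) - z)⁻¹) * Vᵀ := by
    rw [greenMatrix, h4]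
    apply Matrix.inv_eq_right_inv
    calc _ = V * diagonal (fun a => (hH.eigenvalues a : ℂ) - z) * (Vᵀ * V) *
          diagonal (fun a => ((hH.eigenvalues a : ℂ) - z)⁻¹) * Vᵀ := by
          simp only [Matrix.mul_assoc]
      _ = 1 := by
          rw [h1', Matrix.mul_one, Matrix.mul_assoc V, Matrix.diagonal_mul_diagonal]
          simp [hne, h2']
  rw [h5, Matrix.trace_mul_comm, ← Matrix.mul_assoc, h1', Matrix.one_mul, Matrix.trace_diagonal]

/-- The quadratic form `w ↦ wᵀ (H' - z)⁻¹ w` at the `i`-th row `w` of `H`, where `H'` arises from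
`H` by isolating `i`. -/
noncomputable def greenSchur (H : Matrix ι ι ℝ) (z : ℂ) (i : ι) : ℂ :=
  ∑ j, ∑ l, (H i j * H i l : ℂ) * greenMatrix (H.isolate i) z j l

/-- With w the `i`-th row, H = H' + e_i wᵀ + w e_iᵀ; the zero diagonal prevents double counting at
(i, i). -/
theorem map_ofReal_eq_isolate_add (hH : H.IsSymm) (hd : ∀ a, H a a = 0) (i : ι) (u : ι → ℂ) :
    H.map Complex.ofReal *ᵥ u = (H.isolate i).map Complex.ofReal *ᵥ u +
      (∑ j, (H i j : ℂ) * u j) • Pi.single i 1 + u i • fun j => (H i j : ℂ) := by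
  ext a
  simp only [mulVec, dotProduct, Matrix.map_apply, Pi.add_apply, Pi.smul_apply, smul_eq_mul]
  by_cases ha : a = i
  · subst ha
    simp [Matrix.isolate, hd]
  · have : ∀ b, (H a b : ℂ) * u b = ((H.isolate i a b : ℝ) : ℂ) * u b +
        if b = i then u i * H i a else 0 := by
      intro b
      by_cases hb : b = i
      · subst hb
        simp [Matrix.isolate, hH.apply a b, mul_comm]
      · simp [Matrix.isolate, ha, hb]
    simp [this, Finset.sum_add_distrib, ha]

theorem greenMatrix_isolate_mulVec_single (hH : H.IsSymm) (hz : 0 < z.im) (i : ι) :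
    greenMatrix (H.isolate i) z *ᵥ Pi.single i 1 = (-z⁻¹) • (Pi.single i 1 : ι → ℂ) := by
  have hz0 : z ≠ 0 := fun h => by simp [h] at hz
  have h1 : ((H.isolate i).map Complex.ofReal - z • (1 : Matrix ι ι ℂ)) *ᵥ
      ((-z⁻¹) • (Pi.single i 1 : ι → ℂ)) = Pi.single i 1 := by
    have h0 : (H.isolate i).map Complex.ofReal *ᵥ (Pi.single i 1 : ι → ℂ) = 0 := by
      ext a
      simp [Matrix.isolate]
    rw [Matrix.mulVec_smul, Matrix.sub_mulVec, h0, Matrix.smul_mulVec, Matrix.one_mulVec, zero_sub,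
      smul_neg, neg_smul, neg_neg, smul_smul, inv_mul_cancel₀ hz0, one_smul]
  rw [← h1, Matrix.mulVec_mulVec, greenMatrix_mul (hH.isolate i) hz, Matrix.one_mulVec, h1]

/-- The Schur complement formula for the diagonal entries of the resolvent. -/
theorem greenMatrix_apply_self_mul (hH : H.IsSymm) (hd : ∀ a, H a a = 0) (hz : 0 < z.im) (i : ι) :
    greenMatrix H z i i * (-z - greenSchur H z i) = 1 := by
  set u : ι → ℂ := fun j => greenMatrix H z j i with hu
  set w : ι → ℂ := fun j => (H i j : ℂ) with hw
  set R := greenMatrix (H.isolate i) z with hR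
  have e1 : (H.map Complex.ofReal - z • (1 : Matrix ι ι ℂ)) *ᵥ u = Pi.single i 1 := by
    have : u = greenMatrix H z *ᵥ Pi.single i 1 := by
      ext j; simp [hu]
    rw [this, Matrix.mulVec_mulVec, mul_greenMatrix hH hz, Matrix.one_mulVec]
  -- The equation (H - z)u = e_i is rewritten for the isolated matrix and then solved with its
  -- resolvent `R`.
  have e2 : ((H.isolate i).map Complex.ofReal - z • (1 : Matrix ι ι ℂ)) *ᵥ u =
      Pi.single i 1 - (w ⬝ᵥ u) • Pi.single i 1 - u i • w := by
    rw [Matrix.sub_mulVec, map_ofReal_eq_isolate_add hH hd i] at e1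
    rw [Matrix.sub_mulVec, eq_sub_iff_add_eq, eq_sub_iff_add_eq]
    refine Eq.trans ?_ e1
    simp only [dotProduct, hw]
    abel
  have e3 : u = (1 - w ⬝ᵥ u) • ((-z⁻¹) • Pi.single i 1) - u i • R *ᵥ w := by
    rw [← greenMatrix_isolate_mulVec_single hH hz i, ← Matrix.mulVec_smul, ← hR,
      ← Matrix.mulVec_smul, ← Matrix.mulVec_sub, sub_smul, one_smul, ← e2, Matrix.mulVec_mulVec,
      greenMatrix_mul (hH.isolate i) hz, Matrix.one_mulVec]
  have hQ : w ⬝ᵥ R *ᵥ w = greenSchur H z i := by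
    simp only [greenSchur, dotProduct, mulVec, Finset.mul_sum, hw]
    refine Finset.sum_congr rfl fun j _ => Finset.sum_congr rfl fun l _ => ?_
    ring
  -- Pairing with `w` kills the e_i term because H i i = 0.
  have e4 : w ⬝ᵥ u = -(u i * greenSchur H z i) := by
    conv_lhs => rw [e3]
    rw [dotProduct_sub, dotProduct_smul, dotProduct_smul, dotProduct_smul, hQ]
    simp [hw, hd]
  -- The `i`-th coordinate reads w·u - z u_i = 1, and w·u is now known.
  have e5 := congrFun e1 i
  rw [Matrix.sub_mulVec, map_ofReal_eq_isolate_add hH hd i] at e5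
  have e6 : (∑ j, (H i j : ℂ) * u j) = w ⬝ᵥ u := rfl
  rw [e6, e4] at e5
  have e7 : ((H.isolate i).map Complex.ofReal *ᵥ u) i = 0 := by
    simp [mulVec, dotProduct, Matrix.isolate]
  simp [Matrix.smul_mulVec, e7, hd] at e5
  change u i * _ = 1
  linear_combination e5

/-- The resolvent identity gives R - R' = -R'ER with E of rank at most two. The trace therefore
splits into two scalar products, each at most 1/(Im z)² by Cauchy-Schwarz. The bound does not depend
on the size, so it becomes negligible after normalization. -/
theorem norm_trace_sub_trace_isolate_le (hH : H.IsSymm) (hd : ∀ a, H a a = 0) (hz : 0 < z.im)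
    (i : ι) (hw : ∑ j, H i j ^ 2 ≤ 1) :
    ‖(greenMatrix H z).trace - (greenMatrix (H.isolate i) z).trace‖ ≤ 2 / z.im ^ 2 := by
  set R := greenMatrix H z with hR
  set R' := greenMatrix (H.isolate i) z with hR'
  set w : ι → ℂ := fun j => (H i j : ℂ) with hwdef
  set E : Matrix ι ι ℂ := Matrix.vecMulVec (Pi.single i 1) w + Matrix.vecMulVec w (Pi.single i 1)
    with hE
  have hHE : H.map Complex.ofReal = (H.isolate i).map Complex.ofReal + E := by
    ext a b
    by_cases ha : a = i <;> by_cases hb : b = i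
    · subst ha; subst hb; simp [Matrix.isolate, hE, hd, hwdef, Matrix.vecMulVec_apply]
    · subst ha; simp [Matrix.isolate, hE, hwdef, Matrix.vecMulVec_apply, hb]
    · subst hb; simp [Matrix.isolate, hE, hwdef, Matrix.vecMulVec_apply, ha, hH.apply a b]
    · simp [Matrix.isolate, hE, hwdef, Matrix.vecMulVec_apply, ha, hb]
  have hsub : R - R' = -(R' * E * R) := by
    have h1 : E = (H.map Complex.ofReal - z • (1 : Matrix ι ι ℂ)) -
        ((H.isolate i).map Complex.ofReal - z • (1 : Matrix ι ι ℂ)) := by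
      rw [hHE]; abel
    rw [h1, Matrix.mul_sub, Matrix.sub_mul, greenMatrix_mul (hH.isolate i) hz, Matrix.mul_assoc,
      mul_greenMatrix hH hz]
    simp [hR, hR']
  have hnw : ∑ j, ‖w j‖ ^ 2 ≤ 1 := by simpa [hwdef] using hw
  have htr : (R' * E * R).trace = (-z⁻¹) * (∑ j, w j * R j i) +
      ∑ j, R i j * (R' *ᵥ w) j := by
    rw [hE, Matrix.mul_add, Matrix.add_mul, Matrix.trace_add]
    congr 1
    · rw [Matrix.mul_vecMulVec, greenMatrix_isolate_mulVec_single hH hz, Matrix.vecMulVec_mul,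
        Matrix.trace_vecMulVec, smul_dotProduct]
      simp [Matrix.vecMul, dotProduct, Pi.single_apply]
    · rw [Matrix.mul_vecMulVec, Matrix.vecMulVec_mul, Matrix.trace_vecMulVec, dotProduct_comm]
      simp [dotProduct]
  have b1 : ‖∑ j, w j * R j i‖ ≤ 1 / z.im := by
    refine le_of_sq_le_sq ?_ (by positivity)
    calc _ ≤ _ := norm_sum_mul_sq_le _ _
      _ ≤ 1 * (1 / z.im ^ 2) :=
        mul_le_mul hnw (sum_norm_sq_greenMatrix_col_le hH hz i) (by positivity) zero_le_one
      _ = (1 / z.im) ^ 2 := by ring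
  have b2 : ‖∑ j, R i j * (R' *ᵥ w) j‖ ≤ 1 / z.im ^ 2 := by
    refine le_of_sq_le_sq ?_ (by positivity)
    have h3 := im_sq_mul_sum_greenMatrix_mulVec_le (hH.isolate i) hz w
    have h4 : ∑ j, ‖(R' *ᵥ w) j‖ ^ 2 ≤ 1 / z.im ^ 2 := by
      rw [le_div_iff₀' (by positivity)]; exact h3.trans hnw
    calc _ ≤ _ := norm_sum_mul_sq_le _ _
      _ ≤ (1 / z.im ^ 2) * (1 / z.im ^ 2) :=
        mul_le_mul (sum_norm_sq_greenMatrix_row_le hH hz i) h4 (by positivity) (by positivity)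
      _ = (1 / z.im ^ 2) ^ 2 := by ring
  have b3 : ‖-z⁻¹‖ ≤ 1 / z.im := by
    rw [norm_neg, norm_inv, ← one_div]
    gcongr
    exact (le_abs_self _).trans (Complex.abs_im_le_norm z)
  rw [← Matrix.trace_sub, hsub, Matrix.trace_neg, norm_neg, htr]
  calc _ ≤ ‖-z⁻¹‖ * ‖∑ j, w j * R j i‖ + ‖∑ j, R i j * (R' *ᵥ w) j‖ := by
        rw [← norm_mul]; exact norm_add_le _ _
    _ ≤ 1 / z.im * (1 / z.im) + 1 / z.im ^ 2 := by gcongr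
    _ = _ := by ring

/-- The error in replacing the quadratic form in the Schur complement formula by its conditional
expectation, for rows of variance `s`. -/
noncomputable def greenFluctuation (H : Matrix ι ι ℝ) (z : ℂ) (s : ℝ) (i : ι) : ℂ :=
  greenSchur H z i -
    (s / Fintype.card ι : ℝ) * ∑ j ∈ Finset.univ.erase i, greenMatrix (H.isolate i) z j j

/-- The Schur formula reads G_ii(-z - s t - e_i) = 1, where e_i is the error in replacing the
quadratic form by s t. Averaging over i gives s t² + z t + 1 = -avg(G_ii e_i), and |G_ii| ≤ 1/Im z.
-/
theorem norm_selfConsistent_le [Nonempty ι] (hH : H.IsSymm) (hd : ∀ a, H a a = 0) (hz : 0 < z.im)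
    (hw : ∀ i, ∑ j, H i j ^ 2 ≤ 1) {s : ℝ} (hs : 0 ≤ s) {t : ℂ}
    (ht : t = (greenMatrix H z).trace / Fintype.card ι) :
    ‖s * t ^ 2 + z * t + 1‖ ≤ 1 / z.im *
      ((∑ i, ‖greenFluctuation H z s i‖) / Fintype.card ι +
        s * (1 / z.im + 2 / z.im ^ 2) / Fintype.card ι) := by
  set k : ℝ := (Fintype.card ι : ℝ) with hk
  have hk0 : 0 < k := by simp [hk, Fintype.card_pos]
  set e : ι → ℂ := fun i => greenSchur H z i - s * t with he
  have hkc : ((Fintype.card ι : ℂ)) = (k : ℂ) := by simp [hk]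
  rw [hkc] at ht
  have hkc0 : (k : ℂ) ≠ 0 := by exact_mod_cast hk0.ne'
  have hbe : ∀ i, ‖e i‖ ≤ ‖greenFluctuation H z s i‖ + s * (1 / z.im + 2 / z.im ^ 2) / k := by
    intro i
    set R' := greenMatrix (H.isolate i) z with hR'
    -- Besides the fluctuation, the error contains the change of trace under isolation and the
    -- omitted diagonal entry at `i`.
    have h1 : e i = greenFluctuation H z s i +
        (s / k : ℝ) * ((R'.trace - (greenMatrix H z).trace) - R' i i) := by
      have : ∑ j ∈ Finset.univ.erase i, R' j j = R'.trace - R' i i := by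
        rw [Matrix.trace, ← Finset.add_sum_erase _ _ (Finset.mem_univ i)]
        simp
      simp only [he, greenFluctuation, ← hk, ← hR', this, ht]
      push_cast
      field_simp
      ring
    rw [h1]
    refine (norm_add_le _ _).trans ?_
    gcongr
    rw [norm_mul, Complex.norm_real, Real.norm_of_nonneg (by positivity), mul_div_right_comm]
    gcongr
    rw [add_comm]
    refine (norm_sub_le _ _).trans (add_le_add ?_ (norm_greenMatrix_apply_le (hH.isolate i) hz i i))
    rw [norm_sub_rev]
    exact norm_trace_sub_trace_isolate_le hH hd hz i (hw i)
  have hid : s * t ^ 2 + z * t + 1 = -((∑ i, greenMatrix H z i i * e i) / k) := by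
    have h2 : ∀ i, greenMatrix H z i i * e i = -1 - (z + s * t) * greenMatrix H z i i := by
      intro i
      have := greenMatrix_apply_self_mul hH hd hz i
      simp only [he]
      linear_combination -this
    have h3 : (greenMatrix H z).trace = k * t := by rw [ht]; field_simp
    simp only [h2, Finset.sum_sub_distrib, ← Finset.mul_sum]
    have h4 : ∑ i, greenMatrix H z i i = k * t := h3
    rw [h4]
    simp only [Finset.sum_const, Finset.card_univ, nsmul_eq_mul, hkc]
    field_simp
    ring
  rw [hid, norm_neg, norm_div, Complex.norm_real, Real.norm_of_nonneg hk0.le, div_le_iff₀ hk0]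
  calc ‖∑ i, greenMatrix H z i i * e i‖ ≤ ∑ i, 1 / z.im * (‖greenFluctuation H z s i‖ +
        s * (1 / z.im + 2 / z.im ^ 2) / k) := by
        refine (norm_sum_le _ _).trans (Finset.sum_le_sum fun i _ => ?_)
        rw [norm_mul]
        exact mul_le_mul (norm_greenMatrix_apply_le hH hz i i) (hbe i) (norm_nonneg _)
          (by positivity)
    _ = _ := by
        rw [← Finset.mul_sum, Finset.sum_add_distrib]
        simp only [Finset.sum_const, Finset.card_univ, nsmul_eq_mul, ← hk]
        field_simp

end Resolvent

/-! ### Independence of edges and diameter two -/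

section EdgeIndicators
open MeasureTheory ProbabilityTheory
open unitInterval

/-- The value of `F` at a graph on `ℕ` depends only on which elements of `S` are edges. -/
def DependsOnEdges {α : Type*} (S : Finset (Sym2 ℕ)) (F : SimpleGraph ℕ → α) : Prop :=
  ∀ g g' : SimpleGraph ℕ, (∀ e ∈ S, e ∈ g.edgeSet ↔ e ∈ g'.edgeSet) → F g = F g'

open Classical in
/-- The indicator of the edge `{u, v}`. -/
noncomputable def adjIndicator (u v : ℕ) (g : SimpleGraph ℕ) : ℝ := if g.Adj u v then 1 else 0

theorem adjIndicator_comm (u v : ℕ) (g : SimpleGraph ℕ) :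
    adjIndicator u v g = adjIndicator v u g := by
  classical simp only [adjIndicator, g.adj_comm u v]

theorem adjIndicator_mul_self (u v : ℕ) (g : SimpleGraph ℕ) :
    adjIndicator u v g * adjIndicator u v g = adjIndicator u v g := by
  simp [adjIndicator]

theorem adjIndicator_nonneg (u v : ℕ) (g : SimpleGraph ℕ) : 0 ≤ adjIndicator u v g := by
  unfold adjIndicator; split_ifs <;> norm_num

theorem adjIndicator_le_one (u v : ℕ) (g : SimpleGraph ℕ) : adjIndicator u v g ≤ 1 := by
  unfold adjIndicator; split_ifs <;> norm_num

theorem dependsOnEdges_adjIndicator {S : Finset (Sym2 ℕ)} {u v : ℕ} (h : s(u, v) ∈ S) :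
    DependsOnEdges S (adjIndicator u v) := by
  intro g g' hg
  have := hg _ h
  simp only [SimpleGraph.mem_edgeSet] at this
  classical simp only [adjIndicator, this]

namespace DependsOnEdges
variable {α : Type*} {S : Finset (Sym2 ℕ)} {F : SimpleGraph ℕ → α}

/-- Factoring through the finite discrete type `S → Prop` gives measurability, finite range and
integrability at once. -/
theorem eq_comp (hF : DependsOnEdges S F) : F =
    (fun q : S → Prop => F (SimpleGraph.fromEdgeSet {e | ∃ h : e ∈ S, q ⟨e, h⟩})) ∘
      fun g e => e.1 ∈ g.edgeSet := by
  ext g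
  refine hF _ _ fun e he => ?_
  simp only [SimpleGraph.edgeSet_fromEdgeSet, Set.mem_sdiff, Set.mem_ofPred_eq, he, exists_true_left]
  refine ⟨fun h => ⟨h, ?_⟩, fun h => h.1⟩
  simpa using g.not_isDiag_of_mem_edgeSet h

theorem measurable [MeasurableSpace α] (hF : DependsOnEdges S F) : Measurable F := by
  rw [hF.eq_comp]
  refine Measurable.of_discrete.comp (measurable_pi_lambda _ fun e => ?_)
  exact measurable_set_mem e.1 |>.comp SimpleGraph.measurable_edgeSet

theorem finite_range (hF : DependsOnEdges S F) : (Set.range F).Finite := by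
  rw [hF.eq_comp]
  exact (Set.finite_range _).subset (Set.range_comp_subset_range _ _)

theorem integrable {E : Type*} [NormedAddCommGroup E] [MeasurableSpace E] [BorelSpace E]
    [SecondCountableTopology E] {F : SimpleGraph ℕ → E} (hF : DependsOnEdges S F)
    (ν : Measure (SimpleGraph ℕ)) [IsFiniteMeasure ν] : Integrable F ν := by
  obtain ⟨C, hC⟩ := hF.finite_range.isBounded.exists_norm_le
  exact Integrable.of_bound hF.measurable.aestronglyMeasurable C
    (.of_forall fun g => hC _ (Set.mem_range_self g))

theorem comp {β : Type*} (hF : DependsOnEdges S F) (φ : α → β) :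
    DependsOnEdges S (fun g => φ (F g)) :=
  fun g g' h => congrArg φ (hF g g' h)

theorem comp₂ {β γ : Type*} {F' : SimpleGraph ℕ → β} (hF : DependsOnEdges S F)
    (hF' : DependsOnEdges S F') (φ : α → β → γ) : DependsOnEdges S (fun g => φ (F g) (F' g)) :=
  fun g g' h => congrArg₂ φ (hF g g' h) (hF' g g' h)

theorem mono {S' : Finset (Sym2 ℕ)} (hF : DependsOnEdges S F) (h : S ⊆ S') :
    DependsOnEdges S' F :=
  fun g g' hg => hF g g' fun e he => hg e (h he)

end DependsOnEdges

/-- In the binomial random graph an edge indicator is independent of the other edges. -/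
theorem integral_adjIndicator_mul {𝕜 : Type*} [RCLike 𝕜] (p : I) {u v : ℕ} (huv : u ≠ v)
    {S : Finset (Sym2 ℕ)} (he : s(u, v) ∉ S) {F : SimpleGraph ℕ → 𝕜} (hF : DependsOnEdges S F) :
    ∫ g, (adjIndicator u v g : 𝕜) * F g ∂(SimpleGraph.binomialRandom ℕ p) =
      ((p : ℝ) : 𝕜) * ∫ g, F g ∂(SimpleGraph.binomialRandom ℕ p) := by
  classical
  -- The marginal laws of the product measure: Bernoulli(p) off the diagonal, and constantly `False`
  -- on it, where both Dirac masses agree.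
  set Q : Sym2 ℕ → Measure Prop := fun e =>
    toNNReal p • Measure.dirac (e ∈ (Sym2.diagSet : Set (Sym2 ℕ))ᶜ) +
      toNNReal (σ p) • Measure.dirac False with hQ
  set Γ : (Sym2 ℕ → Prop) → SimpleGraph ℕ := fun ω => SimpleGraph.fromEdgeSet {e | ω e} with hΓ
  have hset : Measurable (fun ω : Sym2 ℕ → Prop => {e | ω e}) :=
    MeasurableEquiv.setOfPred.measurable
  have hΓm : Measurable Γ := SimpleGraph.measurable_fromEdgeSet.comp hset
  have hν : SimpleGraph.binomialRandom ℕ p = (Measure.infinitePi Q).map Γ := by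
    rw [SimpleGraph.binomialRandom_eq_map, setBernoulli_eq_map, Measure.map_map
      SimpleGraph.measurable_fromEdgeSet hset]
    rfl
  have hadj : DependsOnEdges {s(u, v)} (adjIndicator u v) :=
    dependsOnEdges_adjIndicator (Finset.mem_singleton_self _)
  have hadjm : Measurable (fun g => (adjIndicator u v g : 𝕜)) :=
    (hadj.comp (fun x : ℝ => (x : 𝕜))).measurable
  have hind : iIndepFun (fun (e : Sym2 ℕ) (ω : Sym2 ℕ → Prop) => ω e) (Measure.infinitePi Q) :=
    iIndepFun_infinitePi (X := fun _ => id) fun _ => measurable_id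
  have hind2 := hind.indepFun_finset {s(u, v)} S (by simpa using he) (fun e => measurable_pi_apply e)
  have e1 : (fun ω => (adjIndicator u v (Γ ω) : 𝕜)) =
      (fun q : ({s(u, v)} : Finset (Sym2 ℕ)) → Prop =>
        if q ⟨s(u, v), Finset.mem_singleton_self _⟩ then (1 : 𝕜) else 0) ∘
      fun ω e => ω e.1 := by
    ext ω
    simp only [adjIndicator, hΓ, SimpleGraph.fromEdgeSet_adj, Set.mem_ofPred_eq, Function.comp]
    by_cases h : ω s(u, v) <;> simp [h, huv]
  have e2 : (fun ω => F (Γ ω)) =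
      (fun q : S → Prop => F (SimpleGraph.fromEdgeSet {e | ∃ h : e ∈ S, q ⟨e, h⟩})) ∘
      fun ω e => ω e.1 := by
    ext ω
    refine hF _ _ fun e he => ?_
    simp [hΓ, he]
  have hind3 : (fun ω => (adjIndicator u v (Γ ω) : 𝕜)) ⟂ᵢ[Measure.infinitePi Q]
      (fun ω => F (Γ ω)) := by
    rw [e1, e2]
    exact hind2.comp Measurable.of_discrete Measurable.of_discrete
  have hmean : ∫ ω, (adjIndicator u v (Γ ω) : 𝕜) ∂(Measure.infinitePi Q) = ((p : ℝ) : 𝕜) := by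
    have h1 : (fun ω => (adjIndicator u v (Γ ω) : 𝕜)) =
        fun ω : Sym2 ℕ → Prop => (fun q : Prop => if q then (1 : 𝕜) else 0) (ω s(u, v)) := by
      ext ω
      simp only [adjIndicator, hΓ, SimpleGraph.fromEdgeSet_adj, Set.mem_ofPred_eq]
      by_cases h : ω s(u, v) <;> simp [h, huv]
    rw [h1, ← integral_map (μ := Measure.infinitePi Q) (φ := fun ω => ω s(u, v))
      (f := fun q : Prop => if q then (1 : 𝕜) else 0)
      (measurable_pi_apply _).aemeasurable
      (Measurable.of_discrete).aestronglyMeasurable, Measure.infinitePi_map_eval]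
    have h2 : (s(u, v) ∈ (Sym2.diagSet : Set (Sym2 ℕ))ᶜ) = True := by simp [huv]
    simp only [hQ, h2]
    rw [integral_add_measure, integral_smul_nnreal_measure, integral_smul_nnreal_measure,
      integral_dirac, integral_dirac]
    · simp [NNReal.smul_def, RCLike.real_smul_eq_coe_mul]
    all_goals
      exact Integrable.of_finite
  rw [hν, integral_map hΓm.aemeasurable (f := fun g => (adjIndicator u v g : 𝕜) * F g)
      (hadjm.mul hF.measurable).aestronglyMeasurable,
    integral_map hΓm.aemeasurable hF.measurable.aestronglyMeasurable,
    hind3.integral_fun_mul_eq_mul_integral (hadjm.comp hΓm).aestronglyMeasurable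
      (hF.measurable.comp hΓm).aestronglyMeasurable, hmean]

theorem integral_centered_adjIndicator_mul {𝕜 : Type*} [RCLike 𝕜] (p : I) {u v : ℕ} (huv : u ≠ v)
    {S : Finset (Sym2 ℕ)} (he : s(u, v) ∉ S) {F : SimpleGraph ℕ → 𝕜} (hF : DependsOnEdges S F) :
    ∫ g, ((adjIndicator u v g - p : ℝ) : 𝕜) * F g ∂(SimpleGraph.binomialRandom ℕ p) = 0 := by
  have h1 : DependsOnEdges (insert s(u, v) S) (fun g => (adjIndicator u v g : 𝕜) * F g) :=
    (dependsOnEdges_adjIndicator (Finset.mem_insert_self _ _)).comp₂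
      (hF.mono (Finset.subset_insert _ _)) fun x y => (x : 𝕜) * y
  have h2 : ∀ g, ((adjIndicator u v g - p : ℝ) : 𝕜) * F g =
      (adjIndicator u v g : 𝕜) * F g - ((p : ℝ) : 𝕜) * F g := fun g => by
    push_cast; ring
  simp only [h2]
  rw [integral_sub (h1.integrable _) ((hF.integrable _).const_mul _),
    integral_adjIndicator_mul p huv he hF, integral_const_mul, sub_self]

/-- The candidates u + v + 1 + n exceed `u` and `v`, and each brings two edges that no earlier
factor involves. The dependence claim is part of the induction because independence of the next
factor needs it. -/
theorem integral_prod_one_sub_adjIndicator_mul (p : I) {u v : ℕ} (huv : u ≠ v) (N : ℕ) :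
    DependsOnEdges ((Finset.range (u + v + 1 + N)).sym2)
      (fun g => ∏ n ∈ Finset.range N,
        (1 - adjIndicator u (u + v + 1 + n) g * adjIndicator v (u + v + 1 + n) g)) ∧
    ∫ g, ∏ n ∈ Finset.range N,
      (1 - adjIndicator u (u + v + 1 + n) g * adjIndicator v (u + v + 1 + n) g)
      ∂(SimpleGraph.binomialRandom ℕ p) = (1 - (p : ℝ) ^ 2) ^ N := by
  induction N with
  | zero => exact ⟨fun _ _ _ => by simp, by simp⟩
  | succ N ih =>
    obtain ⟨hdep, hint⟩ := ih
    set x := u + v + 1 + N with hx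
    set F : SimpleGraph ℕ → ℝ := fun g => ∏ n ∈ Finset.range N,
      (1 - adjIndicator u (u + v + 1 + n) g * adjIndicator v (u + v + 1 + n) g) with hF
    have hux : u ≠ x := by omega
    have hvx : v ≠ x := by omega
    have hS : (Finset.range x).sym2 ⊆ (Finset.range (u + v + 1 + (N + 1))).sym2 :=
      Finset.sym2_mono (Finset.range_mono (by omega))
    have hu : s(u, x) ∈ (Finset.range (u + v + 1 + (N + 1))).sym2 := by
      simp; omega
    have hv : s(v, x) ∈ (Finset.range (u + v + 1 + (N + 1))).sym2 := by
      simp; omega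
    have hvF : DependsOnEdges (insert s(v, x) (Finset.range x).sym2)
        (fun g => adjIndicator v x g * F g) :=
      (dependsOnEdges_adjIndicator (Finset.mem_insert_self _ _)).comp₂
        (hdep.mono (Finset.subset_insert _ _)) fun x y => x * y
    have huF : DependsOnEdges (insert s(u, x) (insert s(v, x) (Finset.range x).sym2))
        (fun g => adjIndicator u x g * (adjIndicator v x g * F g)) :=
      (dependsOnEdges_adjIndicator (Finset.mem_insert_self _ _)).comp₂
        (hvF.mono (Finset.subset_insert _ _)) fun x y => x * y
    have hnv : s(v, x) ∉ (Finset.range x).sym2 := by simp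
    have hnu : s(u, x) ∉ insert s(v, x) (Finset.range x).sym2 := by
      simp [huv, hux]
    refine ⟨?_, ?_⟩
    · simp only [Finset.prod_range_succ, ← hx]
      exact (hdep.mono hS).comp₂ ((dependsOnEdges_adjIndicator hu).comp₂
        (dependsOnEdges_adjIndicator hv) fun a b => 1 - a * b) fun a b => a * b
    · have h1 := integral_adjIndicator_mul (𝕜 := ℝ) p hvx hnv hdep
      have h2 := integral_adjIndicator_mul (𝕜 := ℝ) p hux hnu hvF
      simp only [RCLike.ofReal_real_eq_id, id] at h1 h2
      have h3 : ∀ g, ∏ n ∈ Finset.range (N + 1),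
          (1 - adjIndicator u (u + v + 1 + n) g * adjIndicator v (u + v + 1 + n) g) =
          F g - adjIndicator u x g * (adjIndicator v x g * F g) := fun g => by
        rw [Finset.prod_range_succ, ← hx]
        simp only [hF]
        ring
      simp only [h3]
      rw [integral_sub (hdep.integrable _) (huF.integrable _), h2, h1, hint]
      ring

/-- Without a common neighbour the product over the first N candidates equals 1, while its mean is
(1 - p²)^N; Markov's inequality at level 1 concludes. -/
theorem ae_exists_common_neighbor {p : I} (hp : 0 < p) {u v : ℕ} (huv : u ≠ v) :
    ∀ᵐ g ∂(SimpleGraph.binomialRandom ℕ p), ∃ x, g.Adj u x ∧ g.Adj v x := by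
  rw [ae_iff]
  have hle : ∀ N : ℕ, SimpleGraph.binomialRandom ℕ p {g | ¬∃ x, g.Adj u x ∧ g.Adj v x} ≤
      ENNReal.ofReal ((1 - (p : ℝ) ^ 2) ^ N) := by
    intro N
    obtain ⟨hdep, hint⟩ := integral_prod_one_sub_adjIndicator_mul p huv N
    rw [← hint, ofReal_integral_eq_lintegral_ofReal (hdep.integrable _)]
    · refine le_trans (measure_mono ?_)
        ((one_mul _).symm.trans_le (mul_meas_ge_le_lintegral hdep.measurable.ennreal_ofReal 1))
      intro g hg
      simp only [Set.mem_ofPred_eq, not_exists, not_and] at hg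
      have : ∏ n ∈ Finset.range N,
          (1 - adjIndicator u (u + v + 1 + n) g * adjIndicator v (u + v + 1 + n) g) = 1 := by
        refine Finset.prod_eq_one fun n _ => ?_
        have := hg (u + v + 1 + n)
        by_cases h : g.Adj u (u + v + 1 + n)
        · simp [adjIndicator, this h]
        · simp [adjIndicator, h]
      simp [this]
    · refine .of_forall fun g => Finset.prod_nonneg fun n _ => ?_
      have h1 := mul_le_one₀ (adjIndicator_le_one u (u + v + 1 + n) g)
        (adjIndicator_nonneg v (u + v + 1 + n) g) (adjIndicator_le_one v (u + v + 1 + n) g)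
      linarith
  have hp1 : (p : ℝ) ≤ 1 := p.2.2
  have hp0 : (0 : ℝ) < p := hp
  have hlim : Filter.Tendsto (fun N : ℕ => ENNReal.ofReal ((1 - (p : ℝ) ^ 2) ^ N)) Filter.atTop
      (nhds 0) := by
    rw [← ENNReal.ofReal_zero]
    refine ENNReal.tendsto_ofReal (tendsto_pow_atTop_nhds_zero_of_lt_one ?_ ?_) <;> nlinarith
  exact le_antisymm (ge_of_tendsto' hlim hle) bot_le

/-- The infinite binomial random graph almost surely has diameter two. -/
theorem ae_dist_eq {p : I} (hp : 0 < p) : ∀ᵐ g ∂(SimpleGraph.binomialRandom ℕ p), ∀ u v : ℕ,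
    (g.dist u v : ℝ) ^ 2 = if u = v then 0 else 4 - 3 * adjIndicator u v g := by
  have h : ∀ᵐ g ∂(SimpleGraph.binomialRandom ℕ p), ∀ u v : ℕ, u ≠ v →
      ∃ x, g.Adj u x ∧ g.Adj v x := by
    rw [ae_all_iff]; intro u
    rw [ae_all_iff]; intro v
    by_cases huv : u = v
    · simp [huv]
    · filter_upwards [ae_exists_common_neighbor hp huv] with g hg _ using hg
  filter_upwards [h] with g hg u v
  split_ifs with huv
  · simp [huv]
  · by_cases hadj : g.Adj u v
    · rw [SimpleGraph.dist_eq_one_iff_adj.2 hadj]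
      simp [adjIndicator, hadj]
      norm_num
    · obtain ⟨x, hux, hvx⟩ := hg u v huv
      have h2 : g.dist u v ≤ 2 := SimpleGraph.dist_le (.cons hux (.cons hvx.symm .nil))
      have h1 : g.dist u v ≠ 1 := fun h => hadj (SimpleGraph.dist_eq_one_iff_adj.1 h)
      -- `dist` is also 0 between different components, so the path through `x` is needed again.
      have h0 : g.dist u v ≠ 0 := fun h =>
        huv ((SimpleGraph.Reachable.dist_eq_zero_iff ⟨.cons hux (.cons hvx.symm .nil)⟩).1 h)
      have : g.dist u v = 2 := by omega
      rw [this]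
      simp [adjIndicator, hadj]
      norm_num

end EdgeIndicators

/-! ### Second moments of quadratic forms in the edges at a vertex -/

section Fluctuation
open MeasureTheory ProbabilityTheory
open unitInterval

/-- The centered product of two edge indicators at the vertex `i`. -/
noncomputable def centeredPair (p : I) (i j l : ℕ) (g : SimpleGraph ℕ) : ℝ :=
  (adjIndicator i j g - p) * (adjIndicator i l g - p) - if j = l then (p : ℝ) * (1 - p) else 0

theorem centeredPair_comm (p : I) (i j l : ℕ) (g : SimpleGraph ℕ) :
    centeredPair p i j l g = centeredPair p i l j g := by
  simp only [centeredPair, eq_comm (a := j)]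
  ring

/-- For j = l, idempotence of the indicator gives (x - p)² - p(1 - p) = (x - p)(1 - 2p). In both
cases a centered factor splits off, and the cofactor does not involve the edge ij. -/
theorem centeredPair_eq_mul (p : I) (i j l : ℕ) (g : SimpleGraph ℕ) :
    centeredPair p i j l g = (adjIndicator i j g - p) *
      if j = l then 1 - 2 * (p : ℝ) else adjIndicator i l g - p := by
  unfold centeredPair
  split_ifs with h
  · subst h
    linear_combination adjIndicator_mul_self i j g
  · ring

theorem abs_centeredPair_le_one (p : I) (i j l : ℕ) (g : SimpleGraph ℕ) :
    |centeredPair p i j l g| ≤ 1 := by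
  have h0 : (0 : ℝ) ≤ p := p.2.1
  have h1 : (p : ℝ) ≤ 1 := p.2.2
  have hx : ∀ x, |adjIndicator i x g - p| ≤ 1 := fun x => by
    have := adjIndicator_nonneg i x g
    have := adjIndicator_le_one i x g
    rw [abs_le]; constructor <;> linarith
  rw [centeredPair_eq_mul, abs_mul]
  refine mul_le_one₀ (hx j) (abs_nonneg _) ?_
  split_ifs
  · rw [abs_le]; constructor <;> linarith
  · exact hx l

theorem dependsOnEdges_centeredPair (p : I) {S : Finset (Sym2 ℕ)} {i j l : ℕ}
    (hj : s(i, j) ∈ S) (hl : s(i, l) ∈ S) : DependsOnEdges S (centeredPair p i j l) :=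
  (dependsOnEdges_adjIndicator hj).comp₂ (dependsOnEdges_adjIndicator hl)
    fun x y => (x - p) * (y - p) - if j = l then (p : ℝ) * (1 - p) else 0

/-- The edge ij enters only through one centered factor, independent of everything else. -/
theorem integral_centeredPair_mul_eq_zero (p : I) {i j l j' l' : ℕ} (hij : i ≠ j)
    (h1 : j ≠ j') (h2 : j ≠ l') {S : Finset (Sym2 ℕ)} (hS : s(i, j) ∉ S)
    {B : SimpleGraph ℕ → ℂ} (hB : DependsOnEdges S B) :
    ∫ g, (centeredPair p i j l g : ℂ) * centeredPair p i j' l' g * B g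
      ∂(SimpleGraph.binomialRandom ℕ p) = 0 := by
  -- The erasure matters only for l = j, where the cofactor is constant.
  set S' := (insert s(i, l) (insert s(i, j') (insert s(i, l') S))).erase s(i, j) with hS'
  have hSS : S ⊆ S' := fun e he => by
    simp only [hS', Finset.mem_erase, Finset.mem_insert]
    exact ⟨fun h => hS (h ▸ he), by simp [he]⟩
  have hj' : s(i, j') ∈ S' := by
    simp [hS', h1.symm, hij]
  have hl' : s(i, l') ∈ S' := by
    simp [hS', h2.symm, hij]
  have hr : DependsOnEdges S' (fun g => if j = l then 1 - 2 * (p : ℝ) else adjIndicator i l g - p) := by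
    by_cases h : j = l
    · simp only [h, if_true]
      exact fun _ _ _ => rfl
    · simp only [h, if_false]
      have : s(i, l) ∈ S' := by simp [hS', Ne.symm h, hij]
      exact (dependsOnEdges_adjIndicator this).comp fun x => x - (p : ℝ)
  have hF := (hr.comp₂ (dependsOnEdges_centeredPair p hj' hl') fun x y => ((x * y : ℝ) : ℂ)).comp₂
    (hB.mono hSS) fun x y => x * y
  have := integral_centered_adjIndicator_mul (𝕜 := ℂ) p hij (S := S') (by simp [hS']) hF
  rw [← this]
  congr 1
  ext g
  rw [centeredPair_eq_mul p i j l]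
  push_cast
  simp only [Complex.coe_algebraMap]
  ring

/-- If the unordered pairs differ, some index of one pair is absent from the other. The four cases
are the four possible positions of that index. -/
theorem integral_centeredPair_mul_eq_zero_of_ne (p : I) {i j l j' l' : ℕ} (hj : i ≠ j) (hl : i ≠ l)
    (hj' : i ≠ j') (hl' : i ≠ l') (h : (j', l') ≠ (j, l)) (h' : (j', l') ≠ (l, j))
    {S : Finset (Sym2 ℕ)} (hS : ∀ x, s(i, x) ∉ S)
    {B : SimpleGraph ℕ → ℂ} (hB : DependsOnEdges S B) :
    ∫ g, (centeredPair p i j l g : ℂ) * centeredPair p i j' l' g * B g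
      ∂(SimpleGraph.binomialRandom ℕ p) = 0 := by
  by_cases c1 : j ≠ j' ∧ j ≠ l'
  · exact integral_centeredPair_mul_eq_zero p hj c1.1 c1.2 (hS _) hB
  by_cases c2 : l ≠ j' ∧ l ≠ l'
  · simp only [centeredPair_comm p i j l]
    exact integral_centeredPair_mul_eq_zero p hl c2.1 c2.2 (hS _) hB
  by_cases c3 : j' ≠ j ∧ j' ≠ l
  · simp only [mul_comm (centeredPair p i j l _ : ℂ)]
    exact integral_centeredPair_mul_eq_zero p hj' c3.1 c3.2 (hS _) hB
  by_cases c4 : l' ≠ j ∧ l' ≠ l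
  · simp only [mul_comm (centeredPair p i j l _ : ℂ), centeredPair_comm p i j' l']
    exact integral_centeredPair_mul_eq_zero p hl' c4.1 c4.2 (hS _) hB
  exfalso
  simp only [ne_eq, Prod.mk.injEq] at h h'
  grind

/-- The second moment of a quadratic form in the edges at `i` whose coefficients are independent of
these edges. -/
theorem integral_norm_sq_sum_centeredPair_le (p : I) {T : Finset ℕ} {i : ℕ} (hi : i ∉ T)
    {b : ℕ → ℕ → SimpleGraph ℕ → ℂ} (hb : ∀ j l, DependsOnEdges T.sym2 (b j l))
    (hsymm : ∀ j l g, b j l g = b l j g) :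
    ∫ g, ‖∑ α ∈ T ×ˢ T, (centeredPair p i α.1 α.2 g : ℂ) * b α.1 α.2 g‖ ^ 2
      ∂(SimpleGraph.binomialRandom ℕ p) ≤
    2 * ∑ α ∈ T ×ˢ T, ∫ g, ‖b α.1 α.2 g‖ ^ 2 ∂(SimpleGraph.binomialRandom ℕ p) := by
  set ν := SimpleGraph.binomialRandom ℕ p with hν
  have hiS : ∀ x, s(i, x) ∉ T.sym2 := fun x => by simp [hi]
  set B : ℕ × ℕ → ℕ × ℕ → SimpleGraph ℕ → ℂ :=
    fun α β g => b α.1 α.2 g * (starRingEnd ℂ) (b β.1 β.2 g) with hB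
  have hBdep : ∀ α β, DependsOnEdges T.sym2 (B α β) := fun α β =>
    (hb _ _).comp₂ (hb _ _) fun x y => x * (starRingEnd ℂ) y
  set c : ℕ × ℕ → ℕ × ℕ → SimpleGraph ℕ → ℂ := fun α β g =>
    (centeredPair p i α.1 α.2 g : ℂ) * centeredPair p i β.1 β.2 g * B α β g with hc
  have hcdep : ∀ α ∈ T ×ˢ T, ∀ β ∈ T ×ˢ T, DependsOnEdges (insert i T).sym2 (c α β) := by
    intro α hα β hβ
    rw [Finset.mem_product] at hα hβ
    have hmem : ∀ x ∈ T, s(i, x) ∈ (insert i T).sym2 := fun x hx => by simp [hx]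
    exact ((dependsOnEdges_centeredPair p (hmem _ hα.1) (hmem _ hα.2)).comp₂
      (dependsOnEdges_centeredPair p (hmem _ hβ.1) (hmem _ hβ.2)) fun x y => (x : ℂ) * y).comp₂
      ((hBdep α β).mono (Finset.sym2_mono (Finset.subset_insert _ _))) fun x y => x * y
  have hexp : ∀ g, ((‖∑ α ∈ T ×ˢ T, (centeredPair p i α.1 α.2 g : ℂ) * b α.1 α.2 g‖ ^ 2 : ℝ) : ℂ) =
      ∑ α ∈ T ×ˢ T, ∑ β ∈ T ×ˢ T, c α β g := by
    intro g
    rw [Complex.ofReal_pow, ← Complex.mul_conj', map_sum, Finset.sum_mul_sum]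
    refine Finset.sum_congr rfl fun α _ => Finset.sum_congr rfl fun β _ => ?_
    simp only [hc, hB, map_mul, Complex.conj_ofReal]
    ring
  have hint : ((∫ g, ‖∑ α ∈ T ×ˢ T, (centeredPair p i α.1 α.2 g : ℂ) * b α.1 α.2 g‖ ^ 2 ∂ν : ℝ) : ℂ)
      = ∑ α ∈ T ×ˢ T, ∑ β ∈ T ×ˢ T, ∫ g, c α β g ∂ν := by
    rw [← integral_complex_ofReal]
    simp only [hexp]
    rw [integral_finsetSum _ fun α hα => integrable_finsetSum _ fun β hβ =>
      (hcdep α hα β hβ).integrable ν]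
    refine Finset.sum_congr rfl fun α hα => ?_
    rw [integral_finsetSum _ fun β hβ => (hcdep α hα β hβ).integrable ν]
  set d : ℕ × ℕ → ℝ := fun α => ∫ g, ‖b α.1 α.2 g‖ ^ 2 ∂ν with hd
  have hd0 : ∀ α, 0 ≤ d α := fun α => integral_nonneg fun g => by positivity
  -- Only β = α and β = α.swap survive, with coefficients of equal norm by symmetry; hence the
  -- factor 2.
  have hbound : ∀ α ∈ T ×ˢ T, ∀ β ∈ T ×ˢ T, ‖∫ g, c α β g ∂ν‖ ≤
      (if β = α then d α else 0) + if β = α.swap then d α else 0 := by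
    intro α hα β hβ
    rw [Finset.mem_product] at hα hβ
    by_cases h : β = α ∨ β = α.swap
    · have hn : ∀ g, ‖b β.1 β.2 g‖ = ‖b α.1 α.2 g‖ := by
        intro g
        rcases h with rfl | rfl
        · rfl
        · simp [hsymm α.2 α.1]
      have h1 : ‖∫ g, c α β g ∂ν‖ ≤ d α := by
        refine norm_integral_le_of_norm_le ?_ (.of_forall fun g => ?_)
        · exact ((hb α.1 α.2).comp fun x => ‖x‖ ^ 2).integrable ν
        · simp only [hc, hB, norm_mul, Complex.norm_real, RCLike.norm_conj, hn, Real.norm_eq_abs]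
          calc _ ≤ 1 * 1 * (‖b α.1 α.2 g‖ * ‖b α.1 α.2 g‖) := by
                gcongr <;> exact abs_centeredPair_le_one _ _ _ _ _
            _ = _ := by ring
      refine h1.trans ?_
      rcases h with h | h
      · rw [if_pos h]
        have : 0 ≤ if β = α.swap then d α else 0 := by split_ifs <;> simp [hd0]
        linarith
      · rw [if_pos h]
        have : 0 ≤ if β = α then d α else 0 := by split_ifs <;> simp [hd0]
        linarith
    · push Not at h
      have hne : ∀ x ∈ T, i ≠ x := fun x hx hix => hi (hix ▸ hx)
      have := integral_centeredPair_mul_eq_zero_of_ne p (hne _ hα.1) (hne _ hα.2) (hne _ hβ.1)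
        (hne _ hβ.2) h.1 h.2 hiS (hBdep α β)
      simp only [hc]
      rw [this]
      simp [h.1, h.2]
  have hfin : ‖((∫ g, ‖∑ α ∈ T ×ˢ T, (centeredPair p i α.1 α.2 g : ℂ) * b α.1 α.2 g‖ ^ 2 ∂ν : ℝ) : ℂ)‖
      ≤ ∑ α ∈ T ×ˢ T, 2 * d α := by
    rw [hint]
    refine (norm_sum_le _ _).trans (Finset.sum_le_sum fun α hα => ?_)
    refine (norm_sum_le _ _).trans ((Finset.sum_le_sum fun β hβ => hbound α hα β hβ).trans ?_)
    have hsw : α.swap ∈ T ×ˢ T := by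
      rw [Finset.mem_product] at hα ⊢; exact hα.symm
    rw [Finset.sum_add_distrib, Finset.sum_ite_eq' _ _ fun _ => d α,
      Finset.sum_ite_eq' _ _ fun _ => d α, if_pos hα, if_pos hsw]
    linarith
  rw [Finset.mul_sum]
  refine le_trans ?_ hfin
  rw [Complex.norm_real]
  exact Real.le_norm_self _

end Fluctuation

/-! ### Semicircle law for the Stieltjes transform on the imaginary axis -/

section SelfConsistent
open MeasureTheory ProbabilityTheory
open unitInterval

/-- The positive root `y` of `s y² + η y - 1`. -/
noncomputable def semicircleRoot (s η : ℝ) : ℝ := 2 / (η + √(η ^ 2 + 4 * s))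

/-- Uniformity in η is the point: boundedness as η → 0 later excludes mass near zero. -/
theorem semicircleRoot_le {s η : ℝ} (hs : 0 < s) (hη : 0 < η) : semicircleRoot s η ≤ 1 / √s := by
  have h1 : 2 * √s ≤ √(η ^ 2 + 4 * s) := by
    apply Real.le_sqrt_of_sq_le
    rw [mul_pow, Real.sq_sqrt hs.le]
    nlinarith
  have h0 : 0 < √s := Real.sqrt_pos.2 hs
  rw [semicircleRoot, div_le_div_iff₀ (by positivity) h0]
  linarith

/-- The quadratic factors, and its other root -i(η + r)/(2s) lies in the lower half plane, at
distance at least η/s from any t with Im t ≥ 0. A small residual therefore forces t to be close to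
the right root. -/
theorem norm_sub_semicircleRoot_le {s η : ℝ} (hs : 0 < s) (hη : 0 < η) {t : ℂ} (ht : 0 ≤ t.im) :
    ‖t - semicircleRoot s η * Complex.I‖ ≤ 1 / η * ‖s * t ^ 2 + η * Complex.I * t + 1‖ := by
  set r := √(η ^ 2 + 4 * s) with hr
  have hr2 : r ^ 2 = η ^ 2 + 4 * s := Real.sq_sqrt (by positivity)
  have hrη : η ≤ r := Real.le_sqrt_of_sq_le (by linarith)
  have hpos : 0 < η + r := by linarith
  have hfac : (s : ℂ) * t ^ 2 + η * Complex.I * t + 1 = s *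
      (t - semicircleRoot s η * Complex.I) * (t + ((η + r) / (2 * s) : ℝ) * Complex.I) := by
    have hpc : (η + r : ℂ) ≠ 0 := by exact_mod_cast hpos.ne'
    have hsc : (s : ℂ) ≠ 0 := by exact_mod_cast hs.ne'
    have hr2c : (r : ℂ) ^ 2 = η ^ 2 + 4 * s := by exact_mod_cast hr2
    rw [semicircleRoot, ← hr]
    push_cast
    field_simp
    linear_combination (-t * Complex.I) * hr2c + (2 * η + 2 * r) * Complex.I_sq
  have him : (η + r) / (2 * s) ≤ ‖t + ((η + r) / (2 * s) : ℝ) * Complex.I‖ := by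
    refine le_trans ?_ ((le_abs_self _).trans (Complex.abs_im_le_norm _))
    simp only [Complex.add_im, Complex.mul_im, Complex.ofReal_re, Complex.ofReal_im, Complex.I_re,
      Complex.I_im]
    linarith
  rw [hfac, norm_mul, norm_mul, Complex.norm_real, Real.norm_of_nonneg hs.le, one_div,
    ← div_eq_inv_mul, le_div_iff₀ hη]
  have h1 : η ≤ s * ((η + r) / (2 * s)) := by
    field_simp
    linarith
  calc _ ≤ ‖t - semicircleRoot s η * Complex.I‖ * (s * ((η + r) / (2 * s))) := by gcongr
    _ ≤ ‖t - semicircleRoot s η * Complex.I‖ *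
        (s * ‖t + ((η + r) / (2 * s) : ℝ) * Complex.I‖) := by gcongr
    _ = _ := by ring

/-- The normalized centered adjacency matrix of the graph induced on `T`. -/
noncomputable def centeredMatrix (p : I) (T : Finset ℕ) (g : SimpleGraph ℕ) : Matrix T T ℝ :=
  Matrix.of fun a b => if a = b then 0 else (adjIndicator a b g - p) / √(T.card : ℝ)

variable {p : I} {T : Finset ℕ}

theorem centeredMatrix_isSymm (g : SimpleGraph ℕ) : (centeredMatrix p T g).IsSymm := by
  ext a b
  simp [centeredMatrix, adjIndicator_comm (a : ℕ) b, eq_comm (a := a)]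

theorem centeredMatrix_self (g : SimpleGraph ℕ) (a : T) : centeredMatrix p T g a a = 0 := by
  simp [centeredMatrix]

theorem centeredMatrix_sq_le (g : SimpleGraph ℕ) (a b : T) :
    centeredMatrix p T g a b ^ 2 ≤ 1 / T.card := by
  have h0 : (0 : ℝ) ≤ p := p.2.1
  have h1 : (p : ℝ) ≤ 1 := p.2.2
  simp only [centeredMatrix, Matrix.of_apply]
  split_ifs
  · simp
  · rw [div_pow, Real.sq_sqrt (Nat.cast_nonneg _)]
    gcongr
    have := adjIndicator_nonneg a b g
    have := adjIndicator_le_one a b g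
    rw [sq_le_one_iff_abs_le_one, abs_le]
    constructor <;> linarith

theorem sum_centeredMatrix_sq_le (g : SimpleGraph ℕ) (a : T) :
    ∑ b, centeredMatrix p T g a b ^ 2 ≤ 1 := by
  calc _ ≤ ∑ _b : T, 1 / (T.card : ℝ) := Finset.sum_le_sum fun b _ => centeredMatrix_sq_le g a b
    _ ≤ 1 := by
      simp only [Finset.sum_const, Finset.card_univ, Fintype.card_coe, nsmul_eq_mul]
      rw [mul_one_div]
      exact div_self_le_one _

theorem dependsOnEdges_centeredMatrix : DependsOnEdges T.sym2 (centeredMatrix p T) := by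
  intro g g' h
  ext a b
  have : s((a : ℕ), (b : ℕ)) ∈ T.sym2 := by simp
  simp only [centeredMatrix, Matrix.of_apply, dependsOnEdges_adjIndicator this g g' h]

theorem dependsOnEdges_isolate_centeredMatrix (i : T) :
    DependsOnEdges (T.erase i).sym2 (fun g => (centeredMatrix p T g).isolate i) := by
  intro g g' h
  ext a b
  simp only [Matrix.isolate, Matrix.of_apply]
  split_ifs with hab
  · rfl
  · push Not at hab
    have ha : (a : ℕ) ≠ i := fun h => hab.1 (Subtype.ext h)
    have hb : (b : ℕ) ≠ i := fun h => hab.2 (Subtype.ext h)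
    have : s((a : ℕ), (b : ℕ)) ∈ (T.erase i).sym2 := by simp [ha, hb]
    simp only [centeredMatrix, Matrix.of_apply, dependsOnEdges_adjIndicator this g g' h]

/-- The entries of the resolvent with the vertex `i` isolated, extended by zero. -/
noncomputable def isolatedGreen (p : I) (T : Finset ℕ) (z : ℂ) (i : T) (j l : ℕ)
    (g : SimpleGraph ℕ) : ℂ :=
  if h : j ∈ T ∧ l ∈ T then greenMatrix ((centeredMatrix p T g).isolate i) z ⟨j, h.1⟩ ⟨l, h.2⟩ else 0

theorem isolatedGreen_coe (z : ℂ) (i j l : T) (g : SimpleGraph ℕ) :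
    isolatedGreen p T z i j l g = greenMatrix ((centeredMatrix p T g).isolate i) z j l := by
  simp [isolatedGreen]

theorem isolatedGreen_comm (z : ℂ) (i : T) (j l : ℕ) (g : SimpleGraph ℕ) :
    isolatedGreen p T z i j l g = isolatedGreen p T z i l j g := by
  unfold isolatedGreen
  by_cases h : j ∈ T ∧ l ∈ T
  · rw [dif_pos h, dif_pos h.symm]
    exact greenMatrix_apply_comm ((centeredMatrix_isSymm g).isolate i) _ _
  · rw [dif_neg h, dif_neg fun h' => h h'.symm]

theorem dependsOnEdges_isolatedGreen (z : ℂ) (i : T) (j l : ℕ) :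
    DependsOnEdges (T.erase i).sym2 (isolatedGreen p T z i j l) :=
  (dependsOnEdges_isolate_centeredMatrix i).comp fun A =>
    if h : j ∈ T ∧ l ∈ T then greenMatrix A z ⟨j, h.1⟩ ⟨l, h.2⟩ else 0

/-- Terms with an index equal to `i` vanish by the zero diagonal, and the subtracted mean is exactly
the diagonal correction in `centeredPair`. -/
theorem greenFluctuation_centeredMatrix (z : ℂ) (i : T) (g : SimpleGraph ℕ) :
    greenFluctuation (centeredMatrix p T g) z (p * (1 - p)) i = (1 / T.card : ℝ) *
      ∑ α ∈ T.erase i ×ˢ T.erase i, (centeredPair p i α.1 α.2 g : ℂ) *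
        isolatedGreen p T z i α.1 α.2 g := by
  have hk : (0 : ℝ) < T.card := by
    exact_mod_cast Finset.card_pos.2 (⟨i, i.2⟩ : T.Nonempty)
  set h : ℕ → ℝ := fun j => if (i : ℕ) = j then 0 else (adjIndicator i j g - p) / √(T.card : ℝ) with hh
  have hH : ∀ j : T, centeredMatrix p T g i j = h j := fun j => by
    simp only [centeredMatrix, Matrix.of_apply, hh, Subtype.ext_iff]
  have hhi : h i = 0 := by simp [hh]
  have hS : greenSchur (centeredMatrix p T g) z i = ∑ j ∈ T.erase i, ∑ l ∈ T.erase i,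
      (h j * h l : ℂ) * isolatedGreen p T z i j l g := by
    simp only [greenSchur, hH, ← isolatedGreen_coe]
    rw [Finset.sum_coe_sort T fun j => ∑ l : T, (h j * h l : ℂ) * isolatedGreen p T z i j l g,
      ← Finset.sum_erase T (a := (i : ℕ)) (by simp [hhi])]
    refine Finset.sum_congr rfl fun j _ => ?_
    rw [Finset.sum_coe_sort T fun l => (h j * h l : ℂ) * isolatedGreen p T z i j l g,
      ← Finset.sum_erase T (a := (i : ℕ)) (by simp [hhi])]
  have hD : ∑ j ∈ Finset.univ.erase i, greenMatrix ((centeredMatrix p T g).isolate i) z j j =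
      ∑ j ∈ T.erase i, isolatedGreen p T z i j j g := by
    rw [Finset.sum_erase_eq_sub (Finset.mem_univ _), Finset.sum_erase_eq_sub i.2]
    simp only [← isolatedGreen_coe]
    rw [Finset.sum_coe_sort T fun j => isolatedGreen p T z i j j g]
  rw [greenFluctuation, hS, hD, Fintype.card_coe, Finset.sum_product, Finset.mul_sum, Finset.mul_sum,
    ← Finset.sum_sub_distrib]
  refine Finset.sum_congr rfl fun j hj => ?_
  have hd : ∑ l ∈ T.erase i, (if j = l then (((p : ℝ) * (1 - p) : ℝ) : ℂ) else 0) *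
      isolatedGreen p T z i j l g = (((p : ℝ) * (1 - p) : ℝ) : ℂ) * isolatedGreen p T z i j j g := by
    simp only [ite_mul, zero_mul]
    rw [Finset.sum_ite_eq, if_pos hj]
  have hprod : ∀ l ∈ T.erase i, (h j * h l : ℂ) = (1 / T.card : ℝ) *
      (((adjIndicator i j g - p) * (adjIndicator i l g - p) : ℝ) : ℂ) := by
    intro l hl
    have h1 : (i : ℕ) ≠ j := (Finset.ne_of_mem_erase hj).symm
    have h2 : (i : ℕ) ≠ l := (Finset.ne_of_mem_erase hl).symm
    rw [← Complex.ofReal_mul, ← Complex.ofReal_mul]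
    congr 1
    simp only [hh, h1, h2, if_false]
    rw [div_mul_div_comm, Real.mul_self_sqrt hk.le]
    ring
  rw [Finset.sum_congr rfl fun l hl => by rw [hprod l hl]]
  have hrhs : ∀ l, (centeredPair p i j l g : ℂ) * isolatedGreen p T z i j l g =
      (((adjIndicator i j g - p) * (adjIndicator i l g - p) : ℝ) : ℂ) * isolatedGreen p T z i j l g -
      (if j = l then (((p : ℝ) * (1 - p) : ℝ) : ℂ) else 0) * isolatedGreen p T z i j l g := by
    intro l
    rw [← sub_mul, centeredPair, Complex.ofReal_sub]
    congr 2
    split_ifs <;> simp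
  simp only [hrhs, Finset.sum_sub_distrib, hd]
  refine Eq.trans ?_ (mul_sub _ _ _).symm
  congr 1
  · rw [Finset.mul_sum]
    exact Finset.sum_congr rfl fun l _ => mul_assoc _ _ _
  · push_cast
    ring

/-- Each of the k resolvent rows has squared norm at most 1/(Im z)², so the coefficients contribute
at most k/(Im z)² against the prefactor 2/k². -/
theorem integral_norm_sq_greenFluctuation_le {z : ℂ} (hz : 0 < z.im) (i : T) :
    ∫ g, ‖greenFluctuation (centeredMatrix p T g) z (p * (1 - p)) i‖ ^ 2
      ∂(SimpleGraph.binomialRandom ℕ p) ≤ 2 / (T.card * z.im ^ 2) := by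
  set ν := SimpleGraph.binomialRandom ℕ p with hν
  have hk : (0 : ℝ) < T.card := by
    exact_mod_cast Finset.card_pos.2 (⟨i, i.2⟩ : T.Nonempty)
  have h1 := integral_norm_sq_sum_centeredPair_le p (Finset.notMem_erase (i : ℕ) T)
    (b := fun j l => isolatedGreen p T z i j l) (dependsOnEdges_isolatedGreen z i)
    (isolatedGreen_comm z i)
  have h2 : ∑ α ∈ T.erase i ×ˢ T.erase i, ∫ g, ‖isolatedGreen p T z i α.1 α.2 g‖ ^ 2 ∂ν ≤
      T.card * (1 / z.im ^ 2) := by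
    rw [← integral_finsetSum _ fun α _ =>
      ((dependsOnEdges_isolatedGreen z i α.1 α.2).comp fun x => ‖x‖ ^ 2).integrable ν]
    have hle : ∀ g, ∑ α ∈ T.erase i ×ˢ T.erase i, ‖isolatedGreen p T z i α.1 α.2 g‖ ^ 2 ≤
        T.card * (1 / z.im ^ 2) := by
      intro g
      calc _ ≤ ∑ α ∈ T ×ˢ T, ‖isolatedGreen p T z i α.1 α.2 g‖ ^ 2 :=
            Finset.sum_le_sum_of_subset_of_nonneg
              (Finset.product_subset_product (Finset.erase_subset _ _) (Finset.erase_subset _ _))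
              fun _ _ _ => by positivity
        _ = ∑ j : T, ∑ l : T, ‖greenMatrix ((centeredMatrix p T g).isolate i) z j l‖ ^ 2 := by
            rw [Finset.sum_product, ← Finset.sum_coe_sort]
            refine Finset.sum_congr rfl fun j _ => ?_
            rw [← Finset.sum_coe_sort]
            simp only [isolatedGreen_coe]
        _ ≤ ∑ _j : T, 1 / z.im ^ 2 := Finset.sum_le_sum fun j _ =>
            sum_norm_sq_greenMatrix_row_le ((centeredMatrix_isSymm g).isolate i) hz j
        _ = _ := by simp
    calc _ ≤ ∫ _g, (T.card * (1 / z.im ^ 2) : ℝ) ∂ν := by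
          refine integral_mono (integrable_finsetSum _ fun α _ =>
            ((dependsOnEdges_isolatedGreen z i α.1 α.2).comp fun x => ‖x‖ ^ 2).integrable ν)
            (integrable_const _) hle
      _ = _ := by simp
  simp only [greenFluctuation_centeredMatrix, norm_mul, mul_pow, integral_const_mul,
    Complex.norm_real, Real.norm_of_nonneg (show (0 : ℝ) ≤ 1 / T.card by positivity)]
  calc _ ≤ (1 / (T.card : ℝ)) ^ 2 * (2 * (T.card * (1 / z.im ^ 2))) := by
        gcongr
        exact h1.trans (by gcongr)
    _ = _ := by field_simp

theorem dependsOnEdges_greenFluctuation (z : ℂ) (s : ℝ) (i : T) :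
    DependsOnEdges T.sym2 (fun g => greenFluctuation (centeredMatrix p T g) z s i) :=
  dependsOnEdges_centeredMatrix.comp fun A => greenFluctuation A z s i

/-- Used with r = √k, this passes from second to first moments in place of Cauchy-Schwarz for
integrals. -/
theorem le_half_mul_sq_add {r : ℝ} (hr : 0 < r) (x : ℝ) : x ≤ r / 2 * x ^ 2 + 1 / (2 * r) := by
  have h1 : r / 2 * x ^ 2 + 1 / (2 * r) - x = (r * x - 1) ^ 2 / (2 * r) := by
    field_simp
    ring
  have h2 : 0 ≤ (r * x - 1) ^ 2 / (2 * r) := by positivity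
  linarith

theorem integral_norm_greenFluctuation_le {z : ℂ} (hz : 0 < z.im) (i : T) :
    ∫ g, ‖greenFluctuation (centeredMatrix p T g) z (p * (1 - p)) i‖
      ∂(SimpleGraph.binomialRandom ℕ p) ≤ (1 / z.im ^ 2 + 1) / √(T.card : ℝ) := by
  set ν := SimpleGraph.binomialRandom ℕ p with hν
  have hk : (0 : ℝ) < T.card := by
    exact_mod_cast Finset.card_pos.2 (⟨i, i.2⟩ : T.Nonempty)
  set r := √(T.card : ℝ) with hr
  have hr0 : 0 < r := Real.sqrt_pos.2 hk
  have hi1 := ((dependsOnEdges_greenFluctuation (p := p) z (p * (1 - p)) i).comp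
    fun x => ‖x‖).integrable ν
  have hi2 := ((dependsOnEdges_greenFluctuation (p := p) z (p * (1 - p)) i).comp
    fun x => ‖x‖ ^ 2).integrable ν
  have hfin : ∀ c : ℝ, 0 < c → c / 2 * (2 / (c ^ 2 * z.im ^ 2)) + 1 / (2 * c) =
      (1 / z.im ^ 2 + 1 / 2) / c := fun c hc => by
    field_simp
  calc _ ≤ ∫ g, (r / 2 * ‖greenFluctuation (centeredMatrix p T g) z (p * (1 - p)) i‖ ^ 2 +
        1 / (2 * r)) ∂ν := by
        exact integral_mono hi1 ((hi2.const_mul _).add (integrable_const _))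
          fun g => le_half_mul_sq_add hr0 _
    _ = r / 2 * ∫ g, ‖greenFluctuation (centeredMatrix p T g) z (p * (1 - p)) i‖ ^ 2 ∂ν +
        1 / (2 * r) := by
        rw [integral_add (hi2.const_mul _) (integrable_const _), integral_const_mul]
        rw [integral_const, probReal_univ, one_smul]
    _ ≤ r / 2 * (2 / (T.card * z.im ^ 2)) + 1 / (2 * r) := by
        gcongr
        exact integral_norm_sq_greenFluctuation_le hz i
    _ = (1 / z.im ^ 2 + 1 / 2) / r := by
        rw [show (T.card : ℝ) = r ^ 2 from (Real.sq_sqrt hk.le).symm, hfin r hr0]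
    _ ≤ _ := by
        refine div_le_div_of_nonneg_right ?_ hr0.le
        linarith

/-- Each eigenvalue λ contributes Im z/|λ - z|². The sign selects the correct root of the quadratic.
-/
theorem im_trace_greenMatrix_nonneg {ι : Type*} [Fintype ι] [DecidableEq ι] {H : Matrix ι ι ℝ}
    (hH : H.IsSymm) {z : ℂ} (hz : 0 < z.im) : 0 ≤ (greenMatrix H z).trace.im := by
  have hH' : H.IsHermitian := by
    rw [Matrix.IsHermitian, Matrix.conjTranspose_eq_transpose_of_trivial]; exact hH
  rw [trace_greenMatrix hH' hz, Complex.im_sum]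
  refine Finset.sum_nonneg fun a _ => ?_
  rw [Complex.inv_im]
  refine div_nonneg ?_ (Complex.normSq_nonneg _)
  simp [hz.le]

/-- The semicircle law for the Stieltjes transform at `iη`, with a shift of the matrix by
`d / √k`. -/
theorem integral_norm_trace_sub_semicircleRoot_le (hp₀ : 0 < p) (hp₁ : p < 1) {η : ℝ} (hη : 0 < η)
    {d : ℝ} (hd : 0 ≤ d) :
    ∃ C : ℝ, ∀ T : Finset ℕ, T.Nonempty →
      ∫ g, ‖(greenMatrix (centeredMatrix p T g) (η * Complex.I - (d / √(T.card : ℝ) : ℝ))).trace /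
        T.card - semicircleRoot (p * (1 - p)) η * Complex.I‖ ∂(SimpleGraph.binomialRandom ℕ p) ≤
      C / √(T.card : ℝ) := by
  set ν := SimpleGraph.binomialRandom ℕ p with hν
  have hp0 : (0 : ℝ) < p := hp₀
  have hp1 : (p : ℝ) < 1 := hp₁
  set s : ℝ := p * (1 - p) with hs
  have hs0 : 0 < s := mul_pos hp0 (by linarith)
  refine ⟨1 / η * (1 / η * ((1 / η ^ 2 + 1) + s * (1 / η + 2 / η ^ 2)) + d * (1 / η)),
    fun T hT => ?_⟩
  have : Nonempty T := hT.to_subtype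
  have hk1 : (1 : ℝ) ≤ T.card := by exact_mod_cast Finset.card_pos.2 hT
  have hk : (0 : ℝ) < T.card := by linarith
  set r := √(T.card : ℝ) with hr
  have hr0 : 0 < r := Real.sqrt_pos.2 hk
  have hrk : r ≤ T.card := by
    rw [hr, Real.sqrt_le_left hk.le]
    nlinarith
  set z : ℂ := η * Complex.I - (d / r : ℝ) with hzdef
  have hzim : z.im = η := by simp [hzdef]
  have hz : 0 < z.im := by rw [hzim]; exact hη
  set t : SimpleGraph ℕ → ℂ := fun g => (greenMatrix (centeredMatrix p T g) z).trace / T.card with ht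
  have htdep : DependsOnEdges T.sym2 t :=
    dependsOnEdges_centeredMatrix.comp fun A => (greenMatrix A z).trace / T.card
  have htn : ∀ g, ‖t g‖ ≤ 1 / η := by
    intro g
    rw [ht, norm_div, Complex.norm_natCast, div_le_iff₀ hk]
    calc _ ≤ ∑ _i : T, 1 / η := (norm_sum_le _ _).trans (Finset.sum_le_sum fun i _ => by
          rw [← hzim]; exact norm_greenMatrix_apply_le (centeredMatrix_isSymm g) hz i i)
      _ = _ := by simp [mul_comm]
  have hpoint : ∀ g, ‖t g - semicircleRoot s η * Complex.I‖ ≤ 1 / η * (1 / η *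
      ((∑ i, ‖greenFluctuation (centeredMatrix p T g) z s i‖) / T.card +
        s * (1 / η + 2 / η ^ 2) / T.card) + d * (1 / η) / r) := by
    intro g
    have him : 0 ≤ (t g).im := by
      rw [ht, Complex.div_natCast_im]
      exact div_nonneg (im_trace_greenMatrix_nonneg (centeredMatrix_isSymm g) hz) hk.le
    refine (norm_sub_semicircleRoot_le hs0 hη him).trans ?_
    gcongr
    have hsc := norm_selfConsistent_le (centeredMatrix_isSymm g) (centeredMatrix_self g) hz
      (sum_centeredMatrix_sq_le (p := p) g) hs0.le (t := t g) (by rw [ht, Fintype.card_coe])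
    rw [hzim, Fintype.card_coe] at hsc
    -- Replacing `z` by iη costs (d/r)·t, which is of the same order 1/√k as the other errors.
    have heq : (s : ℂ) * t g ^ 2 + η * Complex.I * t g + 1 =
        (s * t g ^ 2 + z * t g + 1) + (d / r : ℝ) * t g := by
      rw [hzdef]; ring
    rw [heq]
    refine (norm_add_le _ _).trans (add_le_add hsc ?_)
    rw [norm_mul, Complex.norm_real, Real.norm_of_nonneg (by positivity)]
    calc _ ≤ d / r * (1 / η) := by gcongr; exact htn g
      _ = _ := by ring
  have hfi : ∀ i : T, Integrable (fun g => ‖greenFluctuation (centeredMatrix p T g) z s i‖) ν :=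
    fun i => ((dependsOnEdges_greenFluctuation z s i).comp fun x => ‖x‖).integrable ν
  have hsum : Integrable (fun g => ∑ i, ‖greenFluctuation (centeredMatrix p T g) z s i‖) ν :=
    integrable_finsetSum _ fun i _ => hfi i
  have hbd : ∫ g, ∑ i, ‖greenFluctuation (centeredMatrix p T g) z s i‖ ∂ν ≤
      T.card * ((1 / η ^ 2 + 1) / r) := by
    rw [integral_finsetSum _ fun i _ => hfi i]
    calc _ ≤ ∑ _i : T, (1 / η ^ 2 + 1) / r := Finset.sum_le_sum fun i _ => by
          rw [← hzim]; exact integral_norm_greenFluctuation_le hz i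
      _ = _ := by simp
  calc _ ≤ ∫ g, 1 / η * (1 / η *
      ((∑ i, ‖greenFluctuation (centeredMatrix p T g) z s i‖) / T.card +
        s * (1 / η + 2 / η ^ 2) / T.card) + d * (1 / η) / r) ∂ν := by
        refine integral_mono ((htdep.comp fun x =>
          ‖x - semicircleRoot s η * Complex.I‖).integrable ν) ?_ hpoint
        exact ((((hsum.div_const _).add (integrable_const _)).const_mul _).add
          (integrable_const _)).const_mul _
    _ = 1 / η * (1 / η *
      ((∫ g, ∑ i, ‖greenFluctuation (centeredMatrix p T g) z s i‖ ∂ν) / T.card +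
        s * (1 / η + 2 / η ^ 2) / T.card) + d * (1 / η) / r) := by
        have hlin : ∀ A : ℝ, 1 / η * (1 / η * (A / T.card + s * (1 / η + 2 / η ^ 2) / T.card) +
            d * (1 / η) / r) = 1 / η * (1 / η) / T.card * A + 1 / η * (1 / η *
            (s * (1 / η + 2 / η ^ 2) / T.card) + d * (1 / η) / r) := fun A => by ring
        simp only [hlin]
        rw [integral_add (hsum.const_mul _) (integrable_const _), integral_const_mul,
          integral_const, probReal_univ, one_smul]
    _ ≤ 1 / η * (1 / η * ((T.card * ((1 / η ^ 2 + 1) / r)) / T.card +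
        s * (1 / η + 2 / η ^ 2) / r) + d * (1 / η) / r) := by gcongr
    _ = _ := by field_simp

end SelfConsistent

/-! ### From Stieltjes transforms to counts of positive and negative eigenvalues -/

section EmpiricalAverage
open Filter Topology

/-- The average of `f` over a finite family of reals. -/
noncomputable def empAvg {ι : Type*} [Fintype ι] (lam : ι → ℝ) (f : ℝ → ℝ) : ℝ :=
  (∑ a, f (lam a)) / Fintype.card ι

section
variable {ι : Type*} [Fintype ι] {lam : ι → ℝ}

theorem empAvg_mono {f g : ℝ → ℝ} (h : ∀ x, f x ≤ g x) : empAvg lam f ≤ empAvg lam g := by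
  unfold empAvg
  gcongr
  exact h _

theorem empAvg_add (f g : ℝ → ℝ) :
    empAvg lam (fun x => f x + g x) = empAvg lam f + empAvg lam g := by
  simp [empAvg, Finset.sum_add_distrib, add_div]

theorem empAvg_sub (f g : ℝ → ℝ) :
    empAvg lam (fun x => f x - g x) = empAvg lam f - empAvg lam g := by
  simp [empAvg, Finset.sum_sub_distrib, sub_div]

theorem empAvg_const_mul (c : ℝ) (f : ℝ → ℝ) :
    empAvg lam (fun x => c * f x) = c * empAvg lam f := by
  simp only [empAvg, ← Finset.mul_sum, mul_div_assoc]

theorem empAvg_const [Nonempty ι] (c : ℝ) : empAvg lam (fun _ => c) = c := by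
  have : (Fintype.card ι : ℝ) ≠ 0 := by exact_mod_cast Fintype.card_ne_zero
  simp [empAvg]

theorem abs_empAvg_le (f : ℝ → ℝ) : |empAvg lam f| ≤ empAvg lam fun x => |f x| := by
  unfold empAvg
  rw [abs_div, Nat.abs_cast]
  gcongr
  exact Finset.abs_sum_le_sum_abs _ _

theorem abs_empAvg_le_of_le [Nonempty ι] {f : ℝ → ℝ} {c : ℝ} (h : ∀ x, |f x| ≤ c) :
    |empAvg lam f| ≤ c :=
  (abs_empAvg_le f).trans ((empAvg_mono h).trans_eq (empAvg_const c))

theorem abs_empAvg_sub_le_of_le [Nonempty ι] {f g : ℝ → ℝ} {c : ℝ} (h : ∀ x, |f x - g x| ≤ c) :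
    |empAvg lam f - empAvg lam g| ≤ c := by
  rw [← empAvg_sub]
  exact abs_empAvg_le_of_le h

theorem re_sum_inv_sub_div (η : ℝ) :
    ((∑ a, ((lam a : ℂ) - η * Complex.I)⁻¹) / Fintype.card ι).re =
      empAvg lam fun x => x / (x ^ 2 + η ^ 2) := by
  rw [Complex.div_natCast_re, Complex.re_sum, empAvg]
  congr 1
  refine Finset.sum_congr rfl fun a _ => ?_
  simp [Complex.inv_re, Complex.normSq_apply, sq]

theorem im_sum_inv_sub_div (η : ℝ) :
    ((∑ a, ((lam a : ℂ) - η * Complex.I)⁻¹) / Fintype.card ι).im =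
      empAvg lam fun x => η / (x ^ 2 + η ^ 2) := by
  rw [Complex.div_natCast_im, Complex.im_sum, empAvg]
  congr 1
  refine Finset.sum_congr rfl fun a _ => ?_
  simp [Complex.inv_im, Complex.normSq_apply, sq]

theorem empAvg_pos_eq : empAvg lam (fun x => if 0 < x then 1 else 0) =
    Nat.card {a // 0 < lam a} / Fintype.card ι := by
  simp [empAvg, Fintype.card_subtype]

theorem empAvg_neg_eq : empAvg lam (fun x => if x < 0 then 1 else 0) =
    Nat.card {a // lam a < 0} / Fintype.card ι := by
  simp [empAvg, Fintype.card_subtype]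

end

theorem abs_div_sq_add_sq_le {η : ℝ} (hη : 0 < η) (x : ℝ) : |x / (x ^ 2 + η ^ 2)| ≤ 1 / η := by
  rw [abs_div, abs_of_pos (show 0 < x ^ 2 + η ^ 2 by positivity),
    div_le_div_iff₀ (by positivity) hη, one_mul]
  nlinarith [sq_nonneg (|x| - η), sq_abs x, abs_nonneg x]

/-- A Lipschitz bound in η uniform in x, which carries convergence from rational to real η. -/
theorem abs_div_sq_add_sq_sub_le {δ η η' : ℝ} (hδ : 0 < δ) (h : δ ≤ η) (h' : δ ≤ η') (x : ℝ) :
    |x / (x ^ 2 + η ^ 2) - x / (x ^ 2 + η' ^ 2)| ≤ |η - η'| / δ ^ 2 := by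
  have hη : 0 < η := hδ.trans_le h
  have hη' : 0 < η' := hδ.trans_le h'
  have h1 : x / (x ^ 2 + η ^ 2) - x / (x ^ 2 + η' ^ 2) =
      (η' - η) * (x * (η + η') / ((x ^ 2 + η ^ 2) * (x ^ 2 + η' ^ 2))) := by
    field_simp
    ring
  rw [h1, abs_mul, abs_sub_comm, div_eq_mul_one_div |η - η'|]
  gcongr
  rw [abs_div, abs_mul, abs_of_pos (show 0 < η + η' by positivity),
    abs_of_pos (show 0 < (x ^ 2 + η ^ 2) * (x ^ 2 + η' ^ 2) by positivity),
    div_le_div_iff₀ (by positivity) (by positivity), one_mul]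
  have a1 : 2 * (|x| * η) ≤ x ^ 2 + η ^ 2 := by nlinarith [sq_nonneg (|x| - η), sq_abs x]
  have a2 : 2 * (|x| * η') ≤ x ^ 2 + η' ^ 2 := by nlinarith [sq_nonneg (|x| - η'), sq_abs x]
  have b1 : δ ^ 2 ≤ x ^ 2 + η ^ 2 := by nlinarith
  have b2 : δ ^ 2 ≤ x ^ 2 + η' ^ 2 := by nlinarith
  have c1 : 2 * (|x| * η) * δ ^ 2 ≤ (x ^ 2 + η ^ 2) * (x ^ 2 + η' ^ 2) := by gcongr
  have c2 : 2 * (|x| * η') * δ ^ 2 ≤ (x ^ 2 + η' ^ 2) * (x ^ 2 + η ^ 2) := by gcongr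
  linarith

theorem continuousOn_div_sq_add_sq (x : ℝ) {δ T : ℝ} (hδ : 0 < δ) (hT : δ ≤ T) :
    ContinuousOn (fun η : ℝ => x / (x ^ 2 + η ^ 2)) (Set.uIcc δ T) := by
  rw [Set.uIcc_of_le hT]
  refine ContinuousOn.div (by fun_prop) (by fun_prop) fun η hη => ?_
  have : 0 < η := hδ.trans_le hη.1
  positivity

theorem arctan_le_self_of_nonneg {x : ℝ} (hx : 0 ≤ x) : Real.arctan x ≤ x := by
  have h := Real.le_tan (Real.arctan_nonneg.2 hx) (Real.arctan_lt_pi_div_two x)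
  rwa [Real.tan_arctan] at h

/-- The integral is arctan(T/x) - arctan(δ/x); the two errors are the missing tails at infinity and
at zero. -/
theorem abs_pi_div_two_sub_integral_le {x δ T : ℝ} (hx : 0 < x) (hδ : 0 < δ) (hT : δ ≤ T) :
    |Real.pi / 2 - ∫ η in δ..T, x / (x ^ 2 + η ^ 2)| ≤ x / T + δ / x := by
  have hT0 : 0 < T := hδ.trans_le hT
  rw [integral_div_sq_add_sq]
  have h1 : Real.arctan (T / x) = Real.pi / 2 - Real.arctan (x / T) := by
    rw [← inv_div, Real.arctan_inv_of_pos (by positivity)]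
  have h2 := arctan_le_self_of_nonneg (show 0 ≤ x / T by positivity)
  have h3 := arctan_le_self_of_nonneg (show 0 ≤ δ / x by positivity)
  have h4 := Real.arctan_nonneg.2 (show 0 ≤ x / T by positivity)
  have h5 := Real.arctan_nonneg.2 (show 0 ≤ δ / x by positivity)
  rw [h1, abs_le]
  constructor <;> linarith

theorem abs_pi_div_two_sub_integral_le_pi {x δ T : ℝ} (hx : 0 < x) (hδ : 0 < δ) (hT : δ ≤ T) :
    |Real.pi / 2 - ∫ η in δ..T, x / (x ^ 2 + η ^ 2)| ≤ Real.pi := by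
  have hT0 : 0 < T := hδ.trans_le hT
  rw [integral_div_sq_add_sq, abs_le]
  have h1 := Real.arctan_lt_pi_div_two (T / x)
  have h2 := Real.arctan_lt_pi_div_two (δ / x)
  have h4 := Real.arctan_nonneg.2 (show 0 ≤ T / x by positivity)
  have h5 := Real.arctan_nonneg.2 (show 0 ≤ δ / x by positivity)
  constructor <;> linarith

/-- The difference of the indicators of the positive and of the negative reals. -/
noncomputable def posSubNeg (x : ℝ) : ℝ := (if 0 < x then 1 else 0) - if x < 0 then 1 else 0

theorem abs_lt_indicator_le {ε : ℝ} (hε : 0 < ε) {x : ℝ} (hx : |x| < ε) :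
    1 ≤ 2 * ε * (ε / (x ^ 2 + ε ^ 2)) := by
  have h : x ^ 2 ≤ ε ^ 2 := sq_le_sq' (by linarith [abs_lt.1 hx]) (abs_lt.1 hx).2.le
  rw [← mul_div_assoc, le_div_iff₀ (by positivity)]
  nlinarith

/-- With cutoffs ε² and 1/ε the error is at most ε|x| + ε for |x| ≥ ε. For 0 < |x| < ε it is at most
π, which the Poisson kernel at scale ε dominates. -/
theorem abs_sign_sub_integral_le {ε : ℝ} (hε : 0 < ε) (hε1 : ε ≤ 1) (x : ℝ) :
    |Real.pi / 2 * posSubNeg x - ∫ η in (ε ^ 2)..(1 / ε), x / (x ^ 2 + η ^ 2)| ≤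
      ε * (2 + x ^ 2) + 2 * Real.pi * ε * (ε / (x ^ 2 + ε ^ 2)) := by
  have hδ : 0 < ε ^ 2 := by positivity
  have hT : ε ^ 2 ≤ 1 / ε := by
    rw [le_div_iff₀ hε]
    calc ε ^ 2 * ε ≤ 1 * 1 := by gcongr; nlinarith
      _ = 1 := one_mul 1
  have hpos : ∀ x : ℝ, 0 < x → |Real.pi / 2 - ∫ η in (ε ^ 2)..(1 / ε), x / (x ^ 2 + η ^ 2)| ≤
      ε * (2 + x ^ 2) + 2 * Real.pi * ε * (ε / (x ^ 2 + ε ^ 2)) := by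
    intro x hx
    have hπ := Real.pi_pos
    rcases lt_or_ge x ε with h | h
    · have h1 := abs_pi_div_two_sub_integral_le_pi hx hδ hT
      have h2 := abs_lt_indicator_le hε (x := x) (by rwa [abs_of_pos hx])
      have h3 : 0 ≤ ε * (2 + x ^ 2) := by positivity
      nlinarith
    · have h1 := abs_pi_div_two_sub_integral_le hx hδ hT
      have h2 : x / (1 / ε) = ε * x := by field_simp
      have h3 : ε ^ 2 / x ≤ ε := by
        rw [div_le_iff₀ hx]; nlinarith
      have h4 : 0 ≤ 2 * Real.pi * ε * (ε / (x ^ 2 + ε ^ 2)) := by positivity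
      nlinarith [sq_nonneg (x - 1)]
  rcases lt_trichotomy x 0 with h | h | h
  · have := hpos (-x) (by linarith)
    simp only [neg_sq, neg_div, intervalIntegral.integral_neg] at this
    rw [show posSubNeg x = -1 by simp [posSubNeg, h, h.le], ← abs_neg]
    convert this using 2
    ring
  · subst h
    have : 0 ≤ 2 * Real.pi * ε * (ε / (0 ^ 2 + ε ^ 2)) := by have := Real.pi_pos; positivity
    simp only [posSubNeg, lt_irrefl, if_false, sub_self, mul_zero, zero_div,
      intervalIntegral.integral_zero, abs_zero]
    positivity
  · rw [show posSubNeg x = 1 by simp [posSubNeg, h, h.le], mul_one]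
    exact hpos x h

section Limits
variable {ι : ℕ → Type*} [∀ n, Fintype (ι n)] {lam : ∀ n, ι n → ℝ}

/-- The indicator of zero is at most 2q times the Poisson kernel at scale q, whose averages have a
limit bounded uniformly in q. -/
theorem tendsto_empAvg_zero {Y : ℝ} {y : ℝ → ℝ} (hY : ∀ q : ℚ, 0 < q → y q ≤ Y)
    (heven : ∀ q : ℚ, 0 < q →
      Tendsto (fun n => empAvg (lam n) fun x => (q : ℝ) / (x ^ 2 + (q : ℝ) ^ 2)) atTop (𝓝 (y q))) :
    Tendsto (fun n => empAvg (lam n) fun x => if x = 0 then 1 else 0) atTop (𝓝 0) := by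
  rw [Metric.tendsto_atTop]
  intro ε hε
  obtain ⟨q, hq0, hq⟩ := exists_rat_btwn (show (0 : ℝ) < ε / (2 * (|Y| + 1)) by positivity)
  have hq0' : 0 < q := by exact_mod_cast hq0
  obtain ⟨N, hN⟩ := eventually_atTop.1 ((heven q hq0').eventually
    (ge_mem_nhds (show y q < |Y| + 1 by
      have := hY q hq0'; have := le_abs_self Y; linarith)))
  refine ⟨N, fun n hn => ?_⟩
  have h0 : 0 ≤ empAvg (lam n) fun x => if x = 0 then 1 else 0 := by
    unfold empAvg
    refine div_nonneg (Finset.sum_nonneg fun a _ => ?_) (Nat.cast_nonneg _)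
    dsimp only
    split_ifs <;> norm_num
  rw [Real.dist_0_eq_abs, abs_of_nonneg h0]
  have h1 : (empAvg (lam n) fun x => if x = 0 then 1 else 0) ≤
      2 * q * empAvg (lam n) fun x => (q : ℝ) / (x ^ 2 + (q : ℝ) ^ 2) := by
    rw [← empAvg_const_mul]
    refine empAvg_mono fun x => ?_
    split_ifs with hx
    · exact abs_lt_indicator_le hq0 (by simpa [hx] using hq0)
    · positivity
  rw [lt_div_iff₀ (by positivity)] at hq
  have h2 : 2 * q * (empAvg (lam n) fun x => (q : ℝ) / (x ^ 2 + (q : ℝ) ^ 2)) ≤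
      2 * q * (|Y| + 1) := by gcongr; exact hN n hn
  linarith

variable [∀ n, Nonempty (ι n)]

theorem tendsto_empAvg_odd_of_rat
    (h : ∀ q : ℚ, 0 < q → Tendsto (fun n => empAvg (lam n) fun x => x / (x ^ 2 + (q : ℝ) ^ 2))
      atTop (𝓝 0)) {η : ℝ} (hη : 0 < η) :
    Tendsto (fun n => empAvg (lam n) fun x => x / (x ^ 2 + η ^ 2)) atTop (𝓝 0) := by
  rw [Metric.tendsto_atTop]
  intro ε hε
  obtain ⟨q, hq1, hq2⟩ := exists_rat_btwn (show η < η + ε / 2 * η ^ 2 by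
    have : 0 < ε / 2 * η ^ 2 := by positivity
    linarith)
  have hq0 : 0 < q := by exact_mod_cast hη.trans hq1
  obtain ⟨N, hN⟩ := (Metric.tendsto_atTop.1 (h q hq0)) (ε / 2) (by positivity)
  refine ⟨N, fun n hn => ?_⟩
  have h1 := hN n hn
  rw [Real.dist_0_eq_abs] at h1 ⊢
  have h2 := abs_empAvg_sub_le_of_le (lam := lam n)
    (abs_div_sq_add_sq_sub_le hη le_rfl hq1.le)
  have h3 : |η - q| / η ^ 2 ≤ ε / 2 := by
    rw [div_le_iff₀ (by positivity), abs_sub_comm, abs_of_pos (by linarith)]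
    linarith
  have h4 := abs_sub_abs_le_abs_sub (empAvg (lam n) fun x => x / (x ^ 2 + η ^ 2))
    (empAvg (lam n) fun x => x / (x ^ 2 + (q : ℝ) ^ 2))
  linarith

theorem tendsto_empAvg_integral
    (h : ∀ η : ℝ, 0 < η → Tendsto (fun n => empAvg (lam n) fun x => x / (x ^ 2 + η ^ 2))
      atTop (𝓝 0)) {δ T : ℝ} (hδ : 0 < δ) (hT : δ ≤ T) :
    Tendsto (fun n => empAvg (lam n) fun x => ∫ η in δ..T, x / (x ^ 2 + η ^ 2)) atTop (𝓝 0) := by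
  have hsw : ∀ n, (empAvg (lam n) fun x => ∫ η in δ..T, x / (x ^ 2 + η ^ 2)) =
      ∫ η in δ..T, empAvg (lam n) fun x => x / (x ^ 2 + η ^ 2) := by
    intro n
    simp only [empAvg]
    rw [intervalIntegral.integral_div, intervalIntegral.integral_finsetSum]
    exact fun a _ => (continuousOn_div_sq_add_sq _ hδ hT).intervalIntegrable
  simp only [hsw]
  have := intervalIntegral.tendsto_integral_filter_of_dominated_convergence
    (μ := MeasureTheory.volume) (a := δ) (b := T) (l := atTop)
    (F := fun n η => empAvg (lam n) fun x => x / (x ^ 2 + η ^ 2)) (f := fun _ => (0 : ℝ))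
    (fun _ => 1 / δ) ?_ ?_ ?_ ?_
  · simpa using this
  · refine .of_forall fun n => ContinuousOn.aestronglyMeasurable ?_ measurableSet_uIoc
    refine ContinuousOn.mono ?_ Set.uIoc_subset_uIcc
    exact (continuousOn_finsetSum _ fun a _ => continuousOn_div_sq_add_sq _ hδ hT).div_const _
  · refine .of_forall fun n => .of_forall fun η hη => ?_
    rw [Set.uIoc_of_le hT] at hη
    rw [Real.norm_eq_abs]
    refine (abs_empAvg_le_of_le (abs_div_sq_add_sq_le (hδ.trans hη.1))).trans ?_
    exact one_div_le_one_div_of_le hδ hη.1.le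
  · exact intervalIntegrable_const
  · refine .of_forall fun η hη => ?_
    rw [Set.uIoc_of_le hT] at hη
    exact h η (hδ.trans hη.1)

/-- The sign is approximated by the integrated odd kernel, whose average vanishes in the limit. The
second moment controls large eigenvalues, and the bound `Y` controls those near zero. -/
theorem tendsto_empAvg_posSubNeg {B Y : ℝ} {y : ℝ → ℝ} (hB : ∀ n, empAvg (lam n) (fun x => x ^ 2) ≤ B)
    (hY : ∀ q : ℚ, 0 < q → y q ≤ Y)
    (hodd : ∀ q : ℚ, 0 < q → Tendsto (fun n => empAvg (lam n) fun x => x / (x ^ 2 + (q : ℝ) ^ 2))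
      atTop (𝓝 0))
    (heven : ∀ q : ℚ, 0 < q →
      Tendsto (fun n => empAvg (lam n) fun x => (q : ℝ) / (x ^ 2 + (q : ℝ) ^ 2)) atTop (𝓝 (y q))) :
    Tendsto (fun n => empAvg (lam n) posSubNeg) atTop (𝓝 0) := by
  have hπ := Real.pi_pos
  have hB0 : 0 ≤ B := le_trans (by unfold empAvg; positivity) (hB 0)
  set C := (2 + B) + 2 * Real.pi * (|Y| + 1) with hC
  have hC0 : 0 < C := by positivity
  have key : ∀ q : ℚ, 0 < q → q ≤ 1 → ∀ᶠ n in atTop,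
      |Real.pi / 2 * empAvg (lam n) posSubNeg| ≤ q * C + q := by
    intro q hq hq1
    have hqr : (0 : ℝ) < q := by exact_mod_cast hq
    have hqr1 : (q : ℝ) ≤ 1 := by exact_mod_cast hq1
    have hT : (q : ℝ) ^ 2 ≤ 1 / q := by
      rw [le_div_iff₀ hqr]
      calc (q : ℝ) ^ 2 * q ≤ 1 * 1 := by gcongr; nlinarith
        _ = 1 := one_mul 1
    have h1 := tendsto_empAvg_integral (fun η hη => tendsto_empAvg_odd_of_rat hodd hη)
      (show 0 < (q : ℝ) ^ 2 by positivity) hT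
    have h2 := (heven q hq).eventually (ge_mem_nhds (show y q < |Y| + 1 by
      have := hY q hq; have := le_abs_self Y; linarith))
    have h3 := (h1.abs).eventually (ge_mem_nhds (show |(0 : ℝ)| < q by simpa using hqr))
    filter_upwards [h2, h3] with n hn2 hn3
    set g : ℝ → ℝ := fun x => ∫ η in ((q : ℝ) ^ 2)..(1 / q), x / (x ^ 2 + η ^ 2) with hg
    have h4 : |empAvg (lam n) (fun x => Real.pi / 2 * posSubNeg x) - empAvg (lam n) g| ≤ q * C := by
      rw [← empAvg_sub]
      refine (abs_empAvg_le _).trans ((empAvg_mono (abs_sign_sub_integral_le hqr hqr1)).trans ?_)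
      rw [empAvg_add, empAvg_const_mul, empAvg_const_mul, empAvg_add, empAvg_const]
      have h5 : 2 * Real.pi * q * empAvg (lam n) (fun x => (q : ℝ) / (x ^ 2 + (q : ℝ) ^ 2)) ≤
          2 * Real.pi * q * (|Y| + 1) := by gcongr
      have h6 : (q : ℝ) * (2 + empAvg (lam n) fun x => x ^ 2) ≤ q * (2 + B) := by
        gcongr; exact hB n
      rw [hC]
      linarith
    rw [empAvg_const_mul] at h4
    have h7 := abs_sub_abs_le_abs_sub (Real.pi / 2 * empAvg (lam n) posSubNeg) (empAvg (lam n) g)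
    linarith
  rw [Metric.tendsto_atTop]
  intro ε hε
  obtain ⟨q, hq0, hq⟩ := exists_rat_btwn (show (0 : ℝ) < min 1 (ε / (C + 1)) by positivity)
  have hq1 : (q : ℝ) < 1 := hq.trans_le (min_le_left _ _)
  have hq2 : (q : ℝ) < ε / (C + 1) := hq.trans_le (min_le_right _ _)
  obtain ⟨N, hN⟩ := eventually_atTop.1 (key q (by exact_mod_cast hq0) (by exact_mod_cast hq1.le))
  refine ⟨N, fun n hn => ?_⟩
  rw [Real.dist_0_eq_abs]
  have h1 := hN n hn
  rw [abs_mul, abs_of_pos (by positivity)] at h1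
  rw [lt_div_iff₀ (by positivity)] at hq2
  have h3 : 1 * |empAvg (lam n) posSubNeg| ≤ Real.pi / 2 * |empAvg (lam n) posSubNeg| := by
    gcongr
    linarith [Real.pi_gt_three]
  linarith

/-- If the Stieltjes transforms on the imaginary axis converge to a bounded imaginary function, then
asymptotically half of the numbers are positive and half are negative. -/
theorem tendsto_card_pos_and_neg {B Y : ℝ} {y : ℝ → ℝ}
    (hB : ∀ n, empAvg (lam n) (fun x => x ^ 2) ≤ B) (hY : ∀ q : ℚ, 0 < q → y q ≤ Y)
    (h : ∀ q : ℚ, 0 < q → Tendsto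
      (fun n => (∑ a, ((lam n a : ℂ) - (q : ℝ) * Complex.I)⁻¹) / Fintype.card (ι n))
      atTop (𝓝 (y q * Complex.I))) :
    Tendsto (fun n => (Nat.card {a // 0 < lam n a} : ℝ) / Fintype.card (ι n)) atTop (𝓝 (1 / 2)) ∧
    Tendsto (fun n => (Nat.card {a // lam n a < 0} : ℝ) / Fintype.card (ι n)) atTop (𝓝 (1 / 2)) := by
  have hodd : ∀ q : ℚ, 0 < q → Tendsto (fun n => empAvg (lam n) fun x => x / (x ^ 2 + (q : ℝ) ^ 2))
      atTop (𝓝 0) := fun q hq => by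
    have := (Complex.continuous_re.tendsto _).comp (h q hq)
    simp only [Function.comp_def, re_sum_inv_sub_div] at this
    simpa using this
  have heven : ∀ q : ℚ, 0 < q → Tendsto
      (fun n => empAvg (lam n) fun x => (q : ℝ) / (x ^ 2 + (q : ℝ) ^ 2)) atTop (𝓝 (y q)) :=
    fun q hq => by
      have := (Complex.continuous_im.tendsto _).comp (h q hq)
      simp only [Function.comp_def, im_sum_inv_sub_div] at this
      simpa using this
  have h1 := tendsto_empAvg_posSubNeg hB hY hodd heven
  have h2 := tendsto_empAvg_zero hY heven
  have hpos : ∀ n, empAvg (lam n) (fun x => if 0 < x then 1 else 0) =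
      1 / 2 * (1 + empAvg (lam n) posSubNeg - empAvg (lam n) fun x => if x = 0 then 1 else 0) := by
    intro n
    have : (fun x : ℝ => if 0 < x then (1 : ℝ) else 0) = fun x =>
        1 / 2 * (1 + posSubNeg x - if x = 0 then 1 else 0) := by
      ext x
      unfold posSubNeg
      rcases lt_trichotomy x 0 with hx | hx | hx
      · simp [hx, hx.not_gt, hx.ne]
      · simp [hx]
      · simp [hx, hx.not_gt, hx.ne']
        norm_num
    rw [this, empAvg_const_mul, empAvg_sub, empAvg_add, empAvg_const]
  have hneg : ∀ n, empAvg (lam n) (fun x => if x < 0 then 1 else 0) =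
      1 / 2 * (1 - empAvg (lam n) posSubNeg - empAvg (lam n) fun x => if x = 0 then 1 else 0) := by
    intro n
    have : (fun x : ℝ => if x < 0 then (1 : ℝ) else 0) = fun x =>
        1 / 2 * (1 - posSubNeg x - if x = 0 then 1 else 0) := by
      ext x
      unfold posSubNeg
      rcases lt_trichotomy x 0 with hx | hx | hx
      · simp [hx, hx.not_gt, hx.ne]
        norm_num
      · simp [hx]
      · simp [hx, hx.not_gt, hx.ne']
    rw [this, empAvg_const_mul, empAvg_sub, empAvg_sub, empAvg_const]
  simp only [← empAvg_pos_eq, ← empAvg_neg_eq, hpos, hneg]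
  constructor
  · have := ((h1.const_add 1).sub h2).const_mul (1 / 2)
    simpa using this
  · have := ((h1.const_sub 1).sub h2).const_mul (1 / 2)
    simpa using this

end Limits

end EmpiricalAverage

/-! ### Inertia under reindexing and under adding a constant matrix -/

section SignatureComparison
open Matrix

variable {ι κ : Type*} [Fintype ι] [DecidableEq ι] [Fintype κ] [DecidableEq κ]

/-- The form is pulled back along e_i ↦ e_(f i). Since `f` need not be injective, this covers
repeated vertices as well as subsets. -/
theorem Matrix.toQuadraticForm'_submatrix_apply (A : Matrix κ κ ℝ) (f : ι → κ) (y : ι → ℝ) :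
    (A.submatrix f f).toQuadraticForm' y = A.toQuadraticForm'
      (Matrix.toLin' (Matrix.of fun k i => if f i = k then (1 : ℝ) else 0) y) := by
  set E : Matrix κ ι ℝ := Matrix.of fun k i => if f i = k then (1 : ℝ) else 0 with hE
  have h : A.submatrix f f = Eᵀ * A * E := by
    ext i j
    simp [Matrix.mul_apply, hE]
  rw [Matrix.toQuadraticForm'_apply_dotProduct, Matrix.toQuadraticForm'_apply_dotProduct, h,
    Matrix.toLin'_apply, ← Matrix.mulVec_mulVec, ← Matrix.mulVec_mulVec, Matrix.dotProduct_mulVec,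
    Matrix.vecMul_transpose]

theorem sigPos_submatrix_le (A : Matrix κ κ ℝ) (f : ι → κ) :
    sigPos (A.submatrix f f).toQuadraticForm' ≤ sigPos A.toQuadraticForm' :=
  sigPos_le_sigPos_of_linearMap _ fun x hx => by
    rwa [Matrix.toQuadraticForm'_submatrix_apply] at hx

theorem sigNeg_submatrix_le (A : Matrix κ κ ℝ) (f : ι → κ) :
    sigNeg (A.submatrix f f).toQuadraticForm' ≤ sigNeg A.toQuadraticForm' :=
  sigNeg_le_sigNeg_of_linearMap _ fun x hx => by
    rwa [Matrix.toQuadraticForm'_submatrix_apply] at hx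

theorem toQuadraticForm'_apply_of_sum_eq_zero {K M : Matrix ι ι ℝ} {c e : ℝ}
    (h : ∀ a b, K a b = c * M a b + e) {x : ι → ℝ} (hx : ∑ a, x a = 0) :
    K.toQuadraticForm' x = c * M.toQuadraticForm' x := by
  simp only [Matrix.toQuadraticForm'_apply_dotProduct, dotProduct, mulVec, h, add_mul,
    Finset.sum_add_distrib, ← Finset.mul_sum, hx, mul_zero, add_zero, mul_assoc]
  rw [Finset.mul_sum]
  exact Finset.sum_congr rfl fun a _ => by ring

/-- The linear functional summing the coordinates. -/
noncomputable def sumCoord (ι : Type*) [Fintype ι] : (ι → ℝ) →ₗ[ℝ] ℝ :=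
  ∑ a : ι, LinearMap.proj a

theorem sumCoord_apply {ι : Type*} [Fintype ι] (x : ι → ℝ) : sumCoord ι x = ∑ a, x a := by
  simp [sumCoord]

/-- On vectors of coordinate sum zero the constant matrix vanishes, so there the two forms agree up
to a positive factor. -/
theorem sigPos_sigNeg_bounds_of_eq_mul_add {K M : Matrix ι ι ℝ} {c e : ℝ} (hc : 0 < c)
    (h : ∀ a b, K a b = c * M a b + e) :
    (sigPos K.toQuadraticForm' ≤ sigPos M.toQuadraticForm' + 1 ∧
      sigPos M.toQuadraticForm' ≤ sigPos K.toQuadraticForm' + 1) ∧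
    (sigNeg K.toQuadraticForm' ≤ sigNeg M.toQuadraticForm' + 1 ∧
      sigNeg M.toQuadraticForm' ≤ sigNeg K.toQuadraticForm' + 1) := by
  have key : ∀ x, sumCoord ι x = 0 → K.toQuadraticForm' x = c * M.toQuadraticForm' x :=
    fun x hx => toQuadraticForm'_apply_of_sum_eq_zero h (by rwa [sumCoord_apply] at hx)
  refine ⟨⟨?_, ?_⟩, ⟨?_, ?_⟩⟩
  · refine sigPos_le_sigPos_add_one_of_linearMap LinearMap.id (sumCoord ι) fun x hx hp => ?_
    rw [key x hx] at hp
    exact pos_of_mul_pos_right hp hc.le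
  · refine sigPos_le_sigPos_add_one_of_linearMap LinearMap.id (sumCoord ι) fun x hx hp => ?_
    rw [LinearMap.id_apply, key x hx]
    positivity
  · refine sigNeg_le_sigNeg_add_one_of_linearMap LinearMap.id (sumCoord ι) fun x hx hp => ?_
    rw [key x hx] at hp
    rw [LinearMap.id_apply]
    by_contra! hn
    nlinarith
  · refine sigNeg_le_sigNeg_add_one_of_linearMap LinearMap.id (sumCoord ι) fun x hx hp => ?_
    rw [LinearMap.id_apply, key x hx]
    nlinarith

theorem sum_sq_eigenvalues {A : Matrix ι ι ℝ} (hA : A.IsHermitian) :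
    ∑ a, hA.eigenvalues a ^ 2 = ∑ a, ∑ b, A a b ^ 2 := by
  have h1 : (A * A).trace = ∑ a, ∑ b, A a b ^ 2 := by
    simp only [Matrix.trace, Matrix.diag, Matrix.mul_apply]
    refine Finset.sum_congr rfl fun a _ => Finset.sum_congr rfl fun b _ => ?_
    have : A b a = A a b := by simpa using hA.apply a b
    rw [this, sq]
  rw [← h1]
  set U : Matrix ι ι ℝ := (hA.eigenvectorUnitary).1 with hU
  have h2 : Uᵀ * U = 1 := by
    have := Unitary.coe_star_mul_self hA.eigenvectorUnitary
    simpa [Matrix.star_eq_conjTranspose] using this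
  have h3 : A = U * diagonal hA.eigenvalues * Uᵀ := by
    have := hA.spectral_theorem
    rw [Unitary.conjStarAlgAut_apply] at this
    simpa [Matrix.star_eq_conjTranspose, Function.comp_def] using this
  have h4 : A * A = U * (diagonal hA.eigenvalues * diagonal hA.eigenvalues) * Uᵀ := by
    calc A * A = U * diagonal hA.eigenvalues * Uᵀ * (U * diagonal hA.eigenvalues * Uᵀ) := by
          rw [← h3]
      _ = U * diagonal hA.eigenvalues * (Uᵀ * U) * diagonal hA.eigenvalues * Uᵀ := by
          simp only [Matrix.mul_assoc]
      _ = _ := by rw [h2, Matrix.mul_one, Matrix.mul_assoc U]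
  rw [h4, Matrix.trace_mul_comm, ← Matrix.mul_assoc, h2, Matrix.one_mul, Matrix.diagonal_mul_diagonal,
    Matrix.trace_diagonal]
  exact Finset.sum_congr rfl fun a _ => sq _

end SignatureComparison

/-! ### Almost sure half-half signature along the sizes (n + 1)⁴ -/

section ShiftedMatrix
open MeasureTheory ProbabilityTheory Filter Topology
open unitInterval

/-- The matrix `(-d(x_i, x_j)² / 2)` of a graph of diameter two. -/
noncomputable def kernelMatrix {ι : Type*} (g : SimpleGraph ℕ) (x : ι → ℕ) : Matrix ι ι ℝ :=
  Matrix.of fun i j => -(1 / 2) * if x i = x j then 0 else 4 - 3 * adjIndicator (x i) (x j) g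

/-- The normalized centered adjacency matrix with the diagonal that makes it proportional to the
kernel matrix up to a constant. -/
noncomputable def shiftedMatrix (p : I) (T : Finset ℕ) (g : SimpleGraph ℕ) : Matrix T T ℝ :=
  centeredMatrix p T g + ((4 - 3 * p) / 3 / √(T.card : ℝ)) • (1 : Matrix T T ℝ)

variable {p : I} {T : Finset ℕ}

theorem shiftedMatrix_isHermitian (g : SimpleGraph ℕ) : (shiftedMatrix p T g).IsHermitian := by
  rw [Matrix.IsHermitian, Matrix.conjTranspose_eq_transpose_of_trivial, shiftedMatrix,
    Matrix.transpose_add, Matrix.transpose_smul, Matrix.transpose_one, centeredMatrix_isSymm]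

theorem kernelMatrix_eq_mul_shiftedMatrix_add (hT : T.Nonempty) (g : SimpleGraph ℕ) (a b : T) :
    kernelMatrix g (fun t : T => (t : ℕ)) a b =
      3 * √(T.card : ℝ) / 2 * shiftedMatrix p T g a b + (3 * p - 4) / 2 := by
  have hk : 0 < √(T.card : ℝ) := Real.sqrt_pos.2 (by exact_mod_cast Finset.card_pos.2 hT)
  simp only [kernelMatrix, shiftedMatrix, centeredMatrix, Matrix.of_apply, Matrix.add_apply,
    Matrix.smul_apply, Matrix.one_apply, SetLike.coe_eq_coe, smul_eq_mul]
  split_ifs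
  · field_simp
    ring
  · field_simp
    ring

/-- Adding a scalar matrix only moves the spectral parameter, so the shift `d` in the semicircle
estimate covers it. -/
theorem greenMatrix_shiftedMatrix (g : SimpleGraph ℕ) (z : ℂ) :
    greenMatrix (shiftedMatrix p T g) z = greenMatrix (centeredMatrix p T g)
      (z - ((4 - 3 * p) / 3 / √(T.card : ℝ) : ℝ)) := by
  have h : (shiftedMatrix p T g).map Complex.ofReal = (centeredMatrix p T g).map Complex.ofReal +
      (((4 - 3 * p) / 3 / √(T.card : ℝ) : ℝ) : ℂ) • (1 : Matrix T T ℂ) := by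
    ext a b
    simp only [shiftedMatrix, Matrix.map_apply, Matrix.add_apply, Matrix.smul_apply,
      Matrix.one_apply, smul_eq_mul]
    split_ifs <;> push_cast <;> ring
  rw [greenMatrix, greenMatrix, h, sub_smul]
  congr 1
  abel

theorem shiftedMatrix_sq_le (g : SimpleGraph ℕ) (a b : T) :
    shiftedMatrix p T g a b ^ 2 ≤ centeredMatrix p T g a b ^ 2 +
      if a = b then 2 / (T.card : ℝ) else 0 := by
  have hp0 : (0 : ℝ) ≤ p := p.2.1
  have hp1 : (p : ℝ) ≤ 1 := p.2.2
  by_cases h : a = b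
  · subst h
    simp only [shiftedMatrix, Matrix.add_apply, Matrix.smul_apply, Matrix.one_apply_eq, smul_eq_mul,
      mul_one, centeredMatrix_self, zero_add, if_true]
    rw [div_pow, Real.sq_sqrt (Nat.cast_nonneg _)]
    -- The base lies between 1/3 and 4/3, and 16/9 < 2.
    have : ((4 - 3 * (p : ℝ)) / 3) ^ 2 ≤ 2 := by nlinarith
    have := div_le_div_of_nonneg_right this (Nat.cast_nonneg (α := ℝ) T.card)
    linarith
  · simp [shiftedMatrix, h]

theorem empAvg_sq_eigenvalues_shiftedMatrix_le [Nonempty T] (g : SimpleGraph ℕ) :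
    empAvg (shiftedMatrix_isHermitian (p := p) (T := T) g).eigenvalues (fun x => x ^ 2) ≤ 3 := by
  have hk : (0 : ℝ) < T.card := by
    have := Fintype.card_pos (α := T)
    rw [Fintype.card_coe] at this
    exact_mod_cast this
  rw [empAvg, sum_sq_eigenvalues, Fintype.card_coe, div_le_iff₀ hk]
  calc _ ≤ ∑ _a : T, (1 + 2 / (T.card : ℝ)) := by
        refine Finset.sum_le_sum fun a _ => ?_
        refine (Finset.sum_le_sum fun b _ => shiftedMatrix_sq_le g a b).trans ?_
        rw [Finset.sum_add_distrib, Finset.sum_ite_eq, if_pos (Finset.mem_univ _)]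
        gcongr
        exact sum_centeredMatrix_sq_le g a
    _ = T.card + 2 := by
        rw [Finset.sum_const, Finset.card_univ, Fintype.card_coe, nsmul_eq_mul]
        field_simp
    _ ≤ 3 * T.card := by
        have : (1 : ℝ) ≤ T.card := by exact_mod_cast hk
        linarith

/-- Borel-Cantelli: nonnegative functions with summable integrals converge to zero almost
everywhere. -/
theorem ae_tendsto_zero_of_summable_integral {Ω : Type*} [MeasurableSpace Ω] {ν : Measure Ω}
    {f : ℕ → Ω → ℝ} (hm : ∀ n, Measurable (f n)) (hi : ∀ n, Integrable (f n) ν)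
    (h0 : ∀ n ω, 0 ≤ f n ω) {u : ℕ → ℝ} (hu : Summable u) (hle : ∀ n, ∫ ω, f n ω ∂ν ≤ u n) :
    ∀ᵐ ω ∂ν, Tendsto (fun n => f n ω) atTop (𝓝 0) := by
  have hm' : ∀ n, Measurable fun ω => ENNReal.ofReal (f n ω) := fun n => (hm n).ennreal_ofReal
  have hint : ∫⁻ ω, ∑' n, ENNReal.ofReal (f n ω) ∂ν ≠ ⊤ := by
    rw [lintegral_tsum fun n => (hm' n).aemeasurable]
    have hle' : ∀ n, ∫⁻ ω, ENNReal.ofReal (f n ω) ∂ν ≤ ENNReal.ofReal (u n) := fun n => by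
      rw [← ofReal_integral_eq_lintegral_ofReal (hi n) (.of_forall (h0 n))]
      exact ENNReal.ofReal_le_ofReal (hle n)
    refine ne_top_of_le_ne_top ?_ (ENNReal.tsum_le_tsum hle')
    exact hu.tsum_ofReal_ne_top
  filter_upwards [ae_lt_top (Measurable.tsum hm') hint] with ω hω
  have := (ENNReal.tendsto_toReal ENNReal.zero_ne_top).comp
    (ENNReal.tendsto_atTop_zero_of_tsum_ne_top hω.ne)
  simpa [Function.comp_def, ENNReal.toReal_ofReal (h0 _ ω)] using this

theorem dependsOnEdges_shiftedMatrix : DependsOnEdges T.sym2 (shiftedMatrix p T) :=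
  dependsOnEdges_centeredMatrix.comp fun A =>
    A + ((4 - 3 * p) / 3 / √(T.card : ℝ)) • (1 : Matrix T T ℝ)

/-- For sizes (n + 1)⁴ the L¹ error C/√k is C/(n + 1)², which is summable. Restricting to rational η
leaves countably many null sets. -/
theorem ae_tendsto_signature_shiftedMatrix (hp₀ : 0 < p) (hp₁ : p < 1) {T : ℕ → Finset ℕ}
    (hT : ∀ n, (T n).card = (n + 1) ^ 4) :
    ∀ᵐ g ∂(SimpleGraph.binomialRandom ℕ p),
      Tendsto (fun n => (sigPos (shiftedMatrix p (T n) g).toQuadraticForm' : ℝ) / (n + 1) ^ 4) atTop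
        (𝓝 (1 / 2)) ∧
      Tendsto (fun n => (sigNeg (shiftedMatrix p (T n) g).toQuadraticForm' : ℝ) / (n + 1) ^ 4) atTop
        (𝓝 (1 / 2)) := by
  set ν := SimpleGraph.binomialRandom ℕ p with hν
  have hp0 : (0 : ℝ) < p := hp₀
  have hp1 : (p : ℝ) < 1 := hp₁
  set s : ℝ := p * (1 - p) with hs
  have hs0 : 0 < s := mul_pos hp0 (by linarith)
  have hne : ∀ n, (T n).Nonempty := fun n => Finset.card_pos.1 (by rw [hT]; positivity)
  have : ∀ n, Nonempty (T n) := fun n => (hne n).to_subtype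
  have hsqrt : ∀ n, √((T n).card : ℝ) = ((n : ℝ) + 1) ^ 2 := fun n => by
    rw [hT, Real.sqrt_eq_iff_eq_sq (by positivity) (by positivity)]
    push_cast
    ring
  have hae : ∀ᵐ g ∂ν, ∀ q : ℚ, 0 < q → Tendsto (fun n =>
      ‖(greenMatrix (shiftedMatrix p (T n) g) ((q : ℝ) * Complex.I)).trace / (T n).card -
        semicircleRoot s q * Complex.I‖) atTop (𝓝 0) := by
    rw [ae_all_iff]
    intro q
    by_cases hq : 0 < q
    · have hqr : (0 : ℝ) < q := by exact_mod_cast hq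
      obtain ⟨C, hC⟩ := integral_norm_trace_sub_semicircleRoot_le hp₀ hp₁ hqr
        (d := (4 - 3 * (p : ℝ)) / 3) (by linarith)
      have hdep : ∀ n, DependsOnEdges (T n).sym2 (fun g =>
          ‖(greenMatrix (shiftedMatrix p (T n) g) ((q : ℝ) * Complex.I)).trace / (T n).card -
            semicircleRoot s q * Complex.I‖) := fun n =>
        dependsOnEdges_shiftedMatrix.comp fun A =>
          ‖(greenMatrix A ((q : ℝ) * Complex.I)).trace / (T n).card - semicircleRoot s q * Complex.I‖
      have hsum : Summable fun n : ℕ => C / ((n : ℝ) + 1) ^ 2 := by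
        have := (summable_nat_add_iff 1).2
          ((Real.summable_one_div_nat_pow (p := 2)).2 (by norm_num))
        simpa [div_eq_mul_inv] using this.mul_left C
      have := ae_tendsto_zero_of_summable_integral (ν := ν) (fun n => (hdep n).measurable)
        (fun n => (hdep n).integrable ν) (fun n g => norm_nonneg _) hsum fun n => by
          simp only [greenMatrix_shiftedMatrix]
          rw [← hsqrt n]
          exact hC (T n) (hne n)
      filter_upwards [this] with g hg _ using hg
    · exact .of_forall fun g h => absurd h hq
  filter_upwards [hae] with g hg
  have hcard : ∀ n, (Fintype.card (T n) : ℝ) = ((n : ℝ) + 1) ^ 4 := fun n => by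
    rw [Fintype.card_coe, hT]; push_cast; ring
  have := tendsto_card_pos_and_neg
    (lam := fun n => (shiftedMatrix_isHermitian (p := p) (T := T n) g).eigenvalues)
    (B := 3) (Y := 1 / √s) (y := semicircleRoot s)
    (fun n => empAvg_sq_eigenvalues_shiftedMatrix_le g)
    (fun q hq => semicircleRoot_le hs0 (by exact_mod_cast hq))
    (fun q hq => by
      have h1 := tendsto_iff_norm_sub_tendsto_zero.2 (hg q hq)
      refine h1.congr fun n => ?_
      rw [trace_greenMatrix (shiftedMatrix_isHermitian (p := p) (T := T n) g)
        (by simpa using hq), Fintype.card_coe])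
  simpa only [hcard, ← Matrix.IsHermitian.sigPos_toQuadraticForm',
    ← Matrix.IsHermitian.sigNeg_toQuadraticForm'] using this

end ShiftedMatrix

/-! ### Interpolation between the sparse sizes by monotonicity -/

section Squeeze
open Filter Topology

open Classical in
-- With n the selected index, τ n ≤ m < τ (n + 1) for large m. Monotonicity squeezes P m, and
-- consecutive normalizations have ratio tending to 1.
theorem tendsto_div_findGreatest_of_monotone {P τ : ℕ → ℕ} (hP : Monotone P) (hτ : ∀ n, n ≤ τ n)
    {c : ℝ} (h : Tendsto (fun n => (P (τ n) : ℝ) / (n + 1) ^ 4) atTop (𝓝 c)) :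
    Tendsto (fun m => (P m : ℝ) / ((Nat.findGreatest (fun n => τ n ≤ m) m : ℕ) + 1) ^ 4) atTop
      (𝓝 c) := by
  set idx : ℕ → ℕ := fun m => Nat.findGreatest (fun n => τ n ≤ m) m with hidx
  have hlim : Tendsto idx atTop atTop := by
    refine tendsto_atTop.2 fun n => ?_
    filter_upwards [eventually_ge_atTop (τ n)] with m hm
    exact Nat.le_findGreatest ((hτ n).trans hm) hm
  -- `Nat.findGreatest` returns 0 when nothing qualifies, so τ 0 ≤ m is required.
  have hlow : ∀ m, τ 0 ≤ m → τ (idx m) ≤ m := fun m hm =>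
    Nat.findGreatest_spec (P := fun n => τ n ≤ m) (Nat.zero_le m) hm
  -- The search stops at `m`; beyond it, n ≤ τ n gives the inequality.
  have hup : ∀ m, m < τ (idx m + 1) := fun m => by
    rcases le_or_gt (idx m + 1) m with h1 | h1
    · exact not_le.1 (Nat.findGreatest_is_greatest (P := fun n => τ n ≤ m) (Nat.lt_succ_self _) h1)
    · exact h1.trans_le (hτ _)
  have hquot : Tendsto (fun n : ℕ => (((n : ℝ) + 2) / (n + 1)) ^ 4) atTop (𝓝 1) := by
    have h1 : Tendsto (fun n : ℕ => 1 + 1 / ((n : ℝ) + 1)) atTop (𝓝 (1 + 0)) :=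
      tendsto_const_nhds.add tendsto_one_div_add_atTop_nhds_zero_nat
    have h2 := h1.pow 4
    simp only [add_zero, one_pow] at h2
    refine h2.congr fun n => ?_
    congr 1
    field_simp
    ring
  have hupper : Tendsto (fun n : ℕ => (P (τ (n + 1)) : ℝ) / (n + 1) ^ 4) atTop (𝓝 c) := by
    have h1 := (h.comp (tendsto_add_atTop_nat 1)).mul hquot
    rw [mul_one] at h1
    refine h1.congr fun n => ?_
    simp only [Function.comp_apply]
    push_cast
    rw [div_pow, show (n : ℝ) + 1 + 1 = n + 2 by ring]
    field_simp
  refine tendsto_of_tendsto_of_tendsto_of_le_of_le' (h.comp hlim) (hupper.comp hlim) ?_ ?_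
  · filter_upwards [eventually_ge_atTop (τ 0)] with m hm
    simp only [Function.comp_apply]
    gcongr
    exact hP (hlow m hm)
  · refine .of_forall fun m => ?_
    simp only [Function.comp_apply]
    gcongr
    exact hP (hup m).le

theorem tendsto_ratio_of_monotone {P Q τ : ℕ → ℕ} (hP : Monotone P) (hQ : Monotone Q)
    (hτ : ∀ n, n ≤ τ n) {c : ℝ} (hc : c ≠ 0)
    (h : Tendsto (fun n => (P (τ n) : ℝ) / (n + 1) ^ 4) atTop (𝓝 c))
    (h' : Tendsto (fun n => (Q (τ n) : ℝ) / (n + 1) ^ 4) atTop (𝓝 c)) :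
    Tendsto (fun m => (P m : ℝ) / Q m) atTop (𝓝 1) := by
  have := (tendsto_div_findGreatest_of_monotone hP hτ h).div
    (tendsto_div_findGreatest_of_monotone hQ hτ h') hc
  rw [div_self hc] at this
  refine this.congr fun m => ?_
  simp only [Pi.div_apply]
  rw [div_div_div_cancel_right₀ (by positivity)]

theorem tendsto_div_pow_of_le_add_one {P Q : ℕ → ℕ} {c : ℝ} (h₁ : ∀ n, P n ≤ Q n + 1)
    (h₂ : ∀ n, Q n ≤ P n + 1) (h : Tendsto (fun n => (Q n : ℝ) / (n + 1) ^ 4) atTop (𝓝 c)) :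
    Tendsto (fun n => (P n : ℝ) / (n + 1) ^ 4) atTop (𝓝 c) := by
  have h0 : Tendsto (fun n : ℕ => 1 / ((n : ℝ) + 1) ^ 4) atTop (𝓝 0) := by
    have := tendsto_one_div_add_atTop_nhds_zero_nat (𝕜 := ℝ) |>.pow 4
    simpa using this
  have hl := h.sub h0
  have hu := h.add h0
  rw [sub_zero] at hl
  rw [add_zero] at hu
  refine tendsto_of_tendsto_of_tendsto_of_le_of_le hl hu (fun n => ?_) (fun n => ?_)
  · have : (Q n : ℝ) ≤ P n + 1 := by exact_mod_cast h₂ n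
    dsimp only
    rw [← sub_div]
    gcongr
    linarith
  · have : (P n : ℝ) ≤ Q n + 1 := by exact_mod_cast h₁ n
    dsimp only
    rw [← add_div]
    gcongr

end Squeeze

/-! ### Sampled vertices, repetitions and measurability -/

section Sampling
open Filter Topology

/-- The distinct values among the first `m` terms of `x`. -/
def sampledVertices (x : ℕ → ℕ) (m : ℕ) : Finset ℕ := (Finset.range m).image x

theorem card_sampledVertices_succ_le (x : ℕ → ℕ) (m : ℕ) :
    (sampledVertices x (m + 1)).card ≤ (sampledVertices x m).card + 1 := by
  rw [sampledVertices, Finset.range_add_one, Finset.image_insert]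
  exact Finset.card_insert_le _ _

theorem exists_le_card_sampledVertices {x : ℕ → ℕ} (hx : (Set.range x).Infinite) (k : ℕ) :
    ∃ m, k ≤ (sampledVertices x m).card := by
  obtain ⟨t, ht, hcard⟩ := hx.exists_subset_card_eq k
  choose! f hf using fun a (ha : a ∈ t) => ht ha
  refine ⟨t.sup f + 1, ?_⟩
  rw [← hcard]
  refine Finset.card_le_card fun a ha => ?_
  rw [sampledVertices, Finset.mem_image]
  exact ⟨f a, Finset.mem_range.2 (Nat.lt_succ_of_le (Finset.le_sup ha)), hf a ha⟩

/-- The number of terms of `x` needed to see `(n + 1)⁴` distinct values. -/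
theorem exists_times_card_sampledVertices_eq {x : ℕ → ℕ} (hx : (Set.range x).Infinite) :
    ∃ τ : ℕ → ℕ, (∀ n, n ≤ τ n) ∧ ∀ n, (sampledVertices x (τ n)).card = (n + 1) ^ 4 := by
  classical
  have key : ∀ n, ∃ m, (sampledVertices x m).card = (n + 1) ^ 4 := by
    intro n
    have hex := exists_le_card_sampledVertices hx ((n + 1) ^ 4)
    -- The count grows by at most one per term, so it is hit exactly at the first time it is
    -- reached.
    refine ⟨Nat.find hex, le_antisymm ?_ (Nat.find_spec hex)⟩
    rcases h : Nat.find hex with _ | j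
    · simp [sampledVertices]
    · have := Nat.find_min hex (m := j) (by omega)
      have := card_sampledVertices_succ_le x j
      omega
  choose τ hτ using key
  refine ⟨τ, fun n => ?_, hτ⟩
  have h1 : (sampledVertices x (τ n)).card ≤ τ n :=
    Finset.card_image_le.trans_eq (Finset.card_range _)
  have h2 : n + 1 ≤ (n + 1) ^ 4 := Nat.le_self_pow (by norm_num) _
  have := hτ n
  omega

/-- Each matrix is a submatrix of the other: through the map `f` onto distinct values, and through a
section `r` of it. -/
theorem sig_kernelMatrix_eq (g : SimpleGraph ℕ) (x : ℕ → ℕ) (m : ℕ) :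
    sigPos (kernelMatrix g fun i : Fin m => x i).toQuadraticForm' =
      sigPos (kernelMatrix g fun t : sampledVertices x m => (t : ℕ)).toQuadraticForm' ∧
    sigNeg (kernelMatrix g fun i : Fin m => x i).toQuadraticForm' =
      sigNeg (kernelMatrix g fun t : sampledVertices x m => (t : ℕ)).toQuadraticForm' := by
  set f : Fin m → sampledVertices x m := fun i =>
    ⟨x i, Finset.mem_image_of_mem x (Finset.mem_range.2 i.2)⟩ with hf
  have hr : ∀ t : sampledVertices x m, ∃ i : Fin m, x i = t := fun t => by
    obtain ⟨i, hi, hit⟩ := Finset.mem_image.1 t.2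
    exact ⟨⟨i, Finset.mem_range.1 hi⟩, hit⟩
  choose r hr using hr
  have h1 : (kernelMatrix g fun i : Fin m => x i) =
      (kernelMatrix g fun t : sampledVertices x m => (t : ℕ)).submatrix f f := rfl
  have h2 : (kernelMatrix g fun t : sampledVertices x m => (t : ℕ)) =
      (kernelMatrix g fun i : Fin m => x i).submatrix r r := by
    ext a b
    simp [kernelMatrix, hr]
  constructor <;> refine le_antisymm ?_ ?_
  · rw [h1]; exact sigPos_submatrix_le _ _
  · rw [h2]; exact sigPos_submatrix_le _ _
  · rw [h1]; exact sigNeg_submatrix_le _ _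
  · rw [h2]; exact sigNeg_submatrix_le _ _

theorem monotone_sigPos_kernelMatrix (g : SimpleGraph ℕ) (x : ℕ → ℕ) :
    Monotone fun m => sigPos (kernelMatrix g fun i : Fin m => x i).toQuadraticForm' := fun _ m' h =>
  sigPos_submatrix_le (kernelMatrix g fun i : Fin m' => x i) (Fin.castLE h)

theorem monotone_sigNeg_kernelMatrix (g : SimpleGraph ℕ) (x : ℕ → ℕ) :
    Monotone fun m => sigNeg (kernelMatrix g fun i : Fin m => x i).toQuadraticForm' := fun _ m' h =>
  sigNeg_submatrix_le (kernelMatrix g fun i : Fin m' => x i) (Fin.castLE h)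

/-- The ratio of the indices of inertia of the kernel matrix. -/
noncomputable def kernelRatio (g : SimpleGraph ℕ) (x : ℕ → ℕ) (m : ℕ) : ℝ :=
  (sigPos (kernelMatrix g fun i : Fin m => x i).toQuadraticForm' : ℝ) /
    sigNeg (kernelMatrix g fun i : Fin m => x i).toQuadraticForm'

theorem ae_tendsto_kernelRatio {p : unitInterval} (hp₀ : 0 < p) (hp₁ : p < 1) {x : ℕ → ℕ}
    (hx : (Set.range x).Infinite) : ∀ᵐ g ∂(SimpleGraph.binomialRandom ℕ p),
      Tendsto (kernelRatio g x) atTop (𝓝 1) := by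
  obtain ⟨τ, hτ, hcard⟩ := exists_times_card_sampledVertices_eq hx
  filter_upwards [ae_tendsto_signature_shiftedMatrix hp₀ hp₁ hcard] with g hg
  have hne : ∀ n, (sampledVertices x (τ n)).Nonempty := fun n =>
    Finset.card_pos.1 (by rw [hcard]; positivity)
  have hb : ∀ n, _ := fun n => sigPos_sigNeg_bounds_of_eq_mul_add
    (K := kernelMatrix g fun t : sampledVertices x (τ n) => (t : ℕ))
    (M := shiftedMatrix p (sampledVertices x (τ n)) g)
    (show 0 < 3 * √((sampledVertices x (τ n)).card : ℝ) / 2 by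
      have : 0 < √((sampledVertices x (τ n)).card : ℝ) :=
        Real.sqrt_pos.2 (by exact_mod_cast Finset.card_pos.2 (hne n))
      positivity)
    (kernelMatrix_eq_mul_shiftedMatrix_add (hne n) g)
  refine tendsto_ratio_of_monotone (monotone_sigPos_kernelMatrix g x)
    (monotone_sigNeg_kernelMatrix g x) hτ (c := 1 / 2) (by norm_num) ?_ ?_
  · refine tendsto_div_pow_of_le_add_one (fun n => ?_) (fun n => ?_) hg.1
    · rw [(sig_kernelMatrix_eq g x (τ n)).1]; exact (hb n).1.1
    · rw [(sig_kernelMatrix_eq g x (τ n)).1]; exact (hb n).1.2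
  · refine tendsto_div_pow_of_le_add_one (fun n => ?_) (fun n => ?_) hg.2
    · rw [(sig_kernelMatrix_eq g x (τ n)).2]; exact (hb n).2.1
    · rw [(sig_kernelMatrix_eq g x (τ n)).2]; exact (hb n).2.2

open Classical in
-- The ratio depends on finitely many truth values, hence factors through a finite discrete type.
-- Joint measurability is what Fubini requires.
theorem measurable_kernelRatio (m : ℕ) :
    Measurable fun q : (ℕ → ℕ) × SimpleGraph ℕ => kernelRatio q.2 q.1 m := by
  set Φ : (Fin m → Fin m → Prop × Prop) → ℝ := fun w =>
    (sigPos (Matrix.of fun i j => (-(1 / 2) * if (w i j).1 then 0 else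
      4 - 3 * if (w i j).2 then 1 else 0 : ℝ)).toQuadraticForm' : ℝ) /
    sigNeg (Matrix.of fun i j => (-(1 / 2) * if (w i j).1 then 0 else
      4 - 3 * if (w i j).2 then 1 else 0 : ℝ)).toQuadraticForm' with hΦ
  have h : (fun q : (ℕ → ℕ) × SimpleGraph ℕ => kernelRatio q.2 q.1 m) =
      Φ ∘ fun q i j => (q.1 i = q.1 j, q.2.Adj (q.1 i) (q.1 j)) := by
    ext q
    simp only [kernelRatio, kernelMatrix, adjIndicator, hΦ, Function.comp_apply]
  rw [h]
  refine Measurable.of_discrete.comp (measurable_pi_lambda _ fun i => measurable_pi_lambda _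
    fun j => Measurable.prodMk ?_ ?_)
  · have h1 : Measurable fun q : (ℕ → ℕ) × SimpleGraph ℕ => (q.1 i, q.1 j) := by fun_prop
    exact (Measurable.of_discrete (f := fun a : ℕ × ℕ => a.1 = a.2)).comp h1
  · have h2 : {q : (ℕ → ℕ) × SimpleGraph ℕ | q.2.Adj (q.1 i) (q.1 j)} =
        ⋃ u : ℕ, ⋃ v : ℕ, {q | q.1 i = u} ∩ {q | q.1 j = v} ∩ {q | q.2.Adj u v} := by
      ext q
      simp
    rw [← measurableSet_setOfPred, h2]
    refine MeasurableSet.iUnion fun u => MeasurableSet.iUnion fun v => ?_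
    have hi : Measurable fun q : (ℕ → ℕ) × SimpleGraph ℕ => q.1 i := by fun_prop
    have hj : Measurable fun q : (ℕ → ℕ) × SimpleGraph ℕ => q.1 j := by fun_prop
    have ha : Measurable fun q : (ℕ → ℕ) × SimpleGraph ℕ => q.2.Adj u v :=
      ((measurable_pi_apply v).comp ((measurable_pi_apply u).comp
        SimpleGraph.measurable_adj)).comp measurable_snd
    exact ((hi (measurableSet_singleton u)).inter (hj (measurableSet_singleton v))).inter
      (measurableSet_setOfPred.2 ha)

theorem distSqMatrix_eq_kernelMatrix {g : SimpleGraph ℕ} (hg : ∀ u v : ℕ,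
    (g.dist u v : ℝ) ^ 2 = if u = v then 0 else 4 - 3 * adjIndicator u v g) {m : ℕ} (x : Fin m → ℕ) :
    distSqMatrix g x = kernelMatrix g x := by
  ext i j
  simp only [distSqMatrix, kernelMatrix, Matrix.of_apply, hg]

theorem signatureRatio_eq_kernelRatio {g : SimpleGraph ℕ} (hg : ∀ u v : ℕ,
    (g.dist u v : ℝ) ^ 2 = if u = v then 0 else 4 - 3 * adjIndicator u v g) (x : ℕ → ℕ) (m : ℕ) :
    signatureRatio g (fun i : Fin m => x i) = kernelRatio g x m := by
  rw [signatureRatio, numPosEigenvalues, numNegEigenvalues,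
    ← Matrix.IsHermitian.sigPos_toQuadraticForm', ← Matrix.IsHermitian.sigNeg_toQuadraticForm',
    distSqMatrix_eq_kernelMatrix hg, kernelRatio]

end Sampling

/-! ### Randomizing the sample -/

section Main
open MeasureTheory ProbabilityTheory Filter Topology

/-- An i.i.d. sequence almost surely takes every value of positive probability. -/
theorem ae_exists_eq_of_iIndepFun {Ω : Type*} [MeasurableSpace Ω] {P : Measure Ω}
    [IsProbabilityMeasure P] {μ : Measure ℕ} [IsProbabilityMeasure μ] {ξ : ℕ → Ω → ℕ}
    (hlaw : ∀ i, HasLaw (ξ i) μ P) (hind : iIndepFun ξ P) {n : ℕ} (hn : 0 < μ {n}) :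
    ∀ᵐ ω ∂P, ∃ i, ξ i ω = n := by
  rw [ae_iff]
  have hlt : μ {n}ᶜ < 1 := by
    rw [prob_compl_eq_one_sub (measurableSet_singleton n)]
    exact ENNReal.sub_lt_self ENNReal.one_ne_top one_ne_zero hn.ne'
  have hle : ∀ N : ℕ, P {ω | ¬∃ i, ξ i ω = n} ≤ μ {n}ᶜ ^ N := by
    intro N
    have h1 := hind.measure_inter_preimage_eq_mul (Finset.range N) (sets := fun _ => {n}ᶜ)
      fun i _ => (measurableSet_singleton n).compl
    have h2 : ∀ i, P (ξ i ⁻¹' {n}ᶜ) = μ {n}ᶜ := fun i => by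
      rw [← (hlaw i).map_eq, Measure.map_apply_of_aemeasurable (hlaw i).aemeasurable
        (measurableSet_singleton n).compl]
    simp only [h2, Finset.prod_const, Finset.card_range] at h1
    rw [← h1]
    refine measure_mono fun ω hω => ?_
    simp only [Set.mem_ofPred_eq, not_exists] at hω
    simp [hω]
  exact le_antisymm (ge_of_tendsto' (ENNReal.tendsto_pow_atTop_nhds_zero_of_lt_one hlt) hle) bot_le

end Main

theorem mainTheorem9 {Ω : Type*} [MeasurableSpace Ω]
    (P : MeasureTheory.Measure Ω) [MeasureTheory.IsProbabilityMeasure P]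
    (p : unitInterval) (hp₀ : 0 < p) (hp₁ : p < 1)
    (G : Ω → SimpleGraph ℕ)
    (hG : ProbabilityTheory.HasLaw G (SimpleGraph.binomialRandom ℕ p) P)
    (μ : MeasureTheory.Measure ℕ) [MeasureTheory.IsProbabilityMeasure μ]
    (hμ : μ.support = Set.univ)
    (ξ : ℕ → Ω → ℕ)
    (hξ_law : ∀ i, ProbabilityTheory.HasLaw (ξ i) μ P)
    (hξ_indep : ProbabilityTheory.iIndepFun ξ P)
    (hGξ : ProbabilityTheory.IndepFun G (fun ω i => ξ i ω) P) :
    ∀ᵐ ω ∂P, Filter.Tendsto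
      (fun m : ℕ => signatureRatio (G ω) (fun i : Fin m => ξ i ω))
      Filter.atTop (nhds 1) := by
  have hpos : ∀ n, 0 < μ {n} := fun n => by
    have h : n ∈ μ.support := by rw [hμ]; trivial
    rw [MeasureTheory.Measure.mem_support_iff_forall] at h
    exact h {n} (by simp)
  have hξm : AEMeasurable (fun ω i => ξ i ω) P :=
    aemeasurable_pi_lambda _ fun i => (hξ_law i).aemeasurable
  have hcover : ∀ᵐ x ∂(P.map fun ω i => ξ i ω), (Set.range x).Infinite := by
    have h1 : ∀ᵐ x ∂(P.map fun ω i => ξ i ω), ∀ n, ∃ i, x i = n := by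
      rw [MeasureTheory.ae_all_iff]
      intro n
      rw [MeasureTheory.ae_map_iff hξm]
      · exact ae_exists_eq_of_iIndepFun hξ_law hξ_indep (hpos n)
      · have : {x : ℕ → ℕ | ∃ i, x i = n} = ⋃ i, (fun x => x i) ⁻¹' {n} := by
          ext x; simp
        rw [this]
        exact MeasurableSet.iUnion fun i => measurable_pi_apply i (measurableSet_singleton n)
    filter_upwards [h1] with x hx
    rw [Set.range_eq_univ.2 hx]
    exact Set.infinite_univ
  have hmeas : MeasurableSet {q : (ℕ → ℕ) × SimpleGraph ℕ |
      Filter.Tendsto (fun m => kernelRatio q.2 q.1 m) Filter.atTop (nhds 1)} :=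
    measurableSet_tendsto _ measurable_kernelRatio
  -- Fubini: the sample is frozen at almost every sequence, and only the graph remains random.
  have hprod : ∀ᵐ q ∂((P.map fun ω i => ξ i ω).prod (SimpleGraph.binomialRandom ℕ p)),
      q ∈ {q : (ℕ → ℕ) × SimpleGraph ℕ |
        Filter.Tendsto (fun m => kernelRatio q.2 q.1 m) Filter.atTop (nhds 1)} := by
    rw [MeasureTheory.Measure.ae_prod_mem_iff_ae_ae_mem hmeas]
    filter_upwards [hcover] with x hx
    exact ae_tendsto_kernelRatio hp₀ hp₁ hx
  -- By independence the product measure is the joint law of the sample and the graph.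
  rw [← hG.map_eq, ← (ProbabilityTheory.indepFun_iff_map_prod_eq_prod_map_map hξm
    hG.aemeasurable).1 hGξ.symm] at hprod
  have hdist := ae_dist_eq (p := p) hp₀
  rw [← hG.map_eq] at hdist
  filter_upwards [MeasureTheory.ae_of_ae_map (hξm.prodMk hG.aemeasurable) hprod,
    MeasureTheory.ae_of_ae_map hG.aemeasurable hdist] with ω hω hd
  simpa only [signatureRatio_eq_kernelRatio hd (fun i => ξ i ω)] using hω
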